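/- Let $n\ge 1$ be an integer, let $\mathbb{N}=\{1,2,3,\dots\}$, and equip $\mathbb{R}^n$ with the norm $\|x\|=\max_{1\le i\le n}|x_i|$. For a function $\varphi:\mathbb{N}\to\mathbb{R}$ let $W(\varphi)$ be the set of all $x\in\mathbb{R}^n$ for which there exist infinitely many rational points $\frac pq\in\mathbb{Q}^n$ (with $p\in\mathbb{Z}^n$, $q\in\mathbb{N}$) such that $\left\|x-\frac pq\right\|<\varphi(q)$. Let $\psi:\mathbb{N}\to(0,\infty)$ be non-increasing with $\psi(s)=o\bigl(s^{-\frac{n+1}{n}}\bigr)$ as $s\to\infty$. Let $$E(\psi)=W(\psi)\setminus\bigcup_{c<1}W(c\psi)$$ be the set of exactly $\psi$-approximable points, and let $$\lambda_\psi=\liminf_{s\to\infty}\frac{-\log\psi(s)}{\log s}\in\left[\tfrac{n+1}{n},+\infty\right]$$ be the lower order of $\psi$ at infinity. Then $$\dim_H E(\psi)=\dim_H W(\psi)=\frac{n+1}{\lambda_\psi},$$ where $\dim_H$ denotes Hausdorff dimension and $\frac{n+1}{\lambda_\psi}=0$ if $\lambda_\psi=+\infty$. -/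

import Mathlib

open Filter Asymptotics
open scoped ENNReal

noncomputable section

/-- The set `W(ψ)` of `ψ`-approximable points of `ℝⁿ`: those `x` for which there are infinitely many
rational points `v = p / q ∈ ℚⁿ` with `‖x - p / q‖ < ψ q`. The norm on `Fin n → ℝ` is the sup norm.
Rational points, not pairs `(p, q)`, are counted; for a non-increasing `ψ` the existence of a
representation `v = p / q` with `‖x - v‖ < ψ q` is the same as this inequality for the
representation in lowest terms. -/
def approximableSet (n : ℕ) (ψ : ℕ → ℝ) : Set (Fin n → ℝ) :=
  {x | {v : Fin n → ℚ | ∃ (q : ℕ) (p : Fin n → ℤ), 0 < q ∧ (∀ i, v i = (p i : ℚ) / (q : ℚ)) ∧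
    ‖x - fun i => (v i : ℝ)‖ < ψ q}.Infinite}

/-- The set `E(ψ) = W(ψ) \ ⋃_{c < 1} W(c ψ)` of exactly `ψ`-approximable points of `ℝⁿ`. -/
def exactApproximableSet (n : ℕ) (ψ : ℕ → ℝ) : Set (Fin n → ℝ) :=
  approximableSet n ψ \ ⋃ (c : ℝ) (_ : c < 1), approximableSet n (fun s => c * ψ s)

/-- The lower order at infinity `λ_ψ = liminf_{s → ∞} (- log ψ(s)) / log s`, an extended real. -/
def lowerOrder (ψ : ℕ → ℝ) : EReal :=
  liminf (fun s : ℕ => ((-Real.log (ψ s) / Real.log (s : ℝ) : ℝ) : EReal)) atTop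

end

/-! Upper bound: in a bounded region, `W(ψ)` is covered by the balls of radius `ψ q` about the `O(q
^ n)` points `p / q`, with `q` beyond any bound, and `∑ q ^ n * ψ q ^ r` converges once `r` exceeds
`(n + 1) / λ`.

Lower bound: for every `r` below `(n + 1) / λ` a Cantor set of dimension at least `r` is built
inside `E(ψ)`. Put `α = (n + 1) / n`. A cube of radius `ρ` is badly approximable if its points keep
distance at least `η * q ^ (-α)` from `p / q` for the heights `q` up to about `ρ ^ (-1 / α)`. By the
simplex lemma the nearby rational points in the next range of heights lie on one hyperplane, which
at least half of the cells of an `M ^ n` grid avoid. So such a cube has `M ^ n / 2` badly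
approximable children of relative size `1 / (2 * M)` (`BadlyApproximableOn.exists_children`), and
iterating yields any dimension `r' < n` if `M` is large.

This subdivision is interrupted infinitely often. Fix a large `s` with `ψ s ≥ s ^ (-L)`, where `L >
λ`, and subdivide until the radius is about `s ^ (-α)`. Dirichlet's theorem puts a rational point `p
/ q` in the cube; bad approximability makes `q` comparable to `s`, and the constants make `q ≤ s`,
whence `ψ q ≥ ψ s`. Continue in a cube of radius `ε / 4 * ψ q` in the shell `(1 - ε) * ψ q ≤ ‖y - p
/ q‖ < ψ q`. Other rational points are too far from `p / q` to spoil this (`le_norm_of_height_le`,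
`BadlyApproximableOn.exists_shell`). With `ε → 0` along the stages, the limit points are exactly
approximable.

Every cube, also one at a jump, has `N` well separated children, so reading branches as base `N`
digits is a Hölder map onto `[0, 1]` (`le_dimH_of_tree`). The jump from radius `s ^ (-α)` to about
`s ^ (-L)` is affordable because `r * L < α * r'`. -/

/-! ### Dimension of limit sets of trees -/

open scoped NNReal in
/-- A lower bound for the Hausdorff dimension of the limit set of an `N`-ary tree of compact sets
whose children of level `j` are separated by at least a constant times `N ^ (-j / r)`. -/
theorem le_dimH_of_tree {X S : Type*} [MetricSpace X] {N : ℕ} (hN : 2 ≤ N) {r C : ℝ≥0}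
    (hr : 0 < r) (B : S → Set X) (I : ℕ → S → Prop) (R : S → S → Prop) (s₀ : S) (hs₀ : I 0 s₀)
    (hB : ∀ j s, I j s → IsCompact (B s) ∧ (B s).Nonempty)
    (hstep : ∀ j s, I j s → ∃ c : Fin N → S,
      (∀ i, I (j + 1) (c i) ∧ R s (c i) ∧ B (c i) ⊆ B s) ∧
      ∀ i i', i ≠ i' → ∀ y ∈ B (c i), ∀ y' ∈ B (c i'),
        ((N : ℝ) ^ j)⁻¹ ≤ C * dist y y' ^ (r : ℝ)) :
    (r : ℝ≥0∞) ≤ dimH {y : X | ∃ σ : ℕ → S, σ 0 = s₀ ∧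
      ∀ j, I j (σ j) ∧ R (σ j) (σ (j + 1)) ∧ y ∈ B (σ j)} := by
  choose c hc hsep using hstep
  let path : (ℕ → Fin N) → (j : ℕ) → {s // I j s} := fun a j =>
    Nat.rec (motive := fun j => {s // I j s}) ⟨s₀, hs₀⟩
      (fun j s => ⟨c j s.1 s.2 (a j), (hc j s.1 s.2 (a j)).1⟩) j
  have hpath_succ : ∀ a j, path a (j + 1) =
      ⟨c j (path a j).1 (path a j).2 (a j), (hc j _ (path a j).2 (a j)).1⟩ := fun a j => rfl
  have hpath_congr : ∀ a b j, (∀ i < j, a i = b i) → path a j = path b j := by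
    intro a b j
    induction j with
    | zero => intro _; rfl
    | succ j ih =>
      intro h
      rw [hpath_succ, hpath_succ, ih fun i hi => h i (by omega)]
      simp only [h j (Nat.lt_succ_self j)]
  have hne : ∀ a, (⋂ j, B (path a j).1).Nonempty := fun a =>
    IsCompact.nonempty_iInter_of_sequence_nonempty_isCompact_isClosed _
      (fun j => (hc j _ (path a j).2 (a j)).2.2) (fun j => (hB j _ (path a j).2).2)
      (hB 0 _ (path a 0).2).1 (fun j => (hB j _ (path a j).2).1.isClosed)
  choose x hx using hne
  simp only [Set.mem_iInter] at hx
  have hN0 : (0 : ℝ) < N := by exact_mod_cast (by omega : 0 < N)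
  -- If `j` is the first index at which the addresses differ, their digit expansions differ by at
  -- most `N ^ (-j)`, which the separation of the children at level `j` dominates.
  have hmain : ∀ a b, a ≠ b →
      0 < dist (x a) (x b) ∧
      |Real.ofDigits a - Real.ofDigits b| ≤ C * dist (x a) (x b) ^ (r : ℝ) := by
    intro a b hab
    have hex : ∃ j, a j ≠ b j := by
      by_contra! h
      exact hab (funext h)
    classical
    set j := Nat.find hex
    have hj : a j ≠ b j := Nat.find_spec hex
    have hlt : ∀ i < j, a i = b i := fun i hi => by
      by_contra h
      exact Nat.find_min hex hi h
    have h1 := hx a (j + 1)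
    have h2 := hx b (j + 1)
    rw [hpath_succ] at h1 h2
    rw [← hpath_congr a b j hlt] at h2
    have h3 := hsep j _ (path a j).2 _ _ hj _ h1 _ h2
    refine ⟨?_, (Real.abs_ofDigits_sub_ofDigits_le hlt).trans h3⟩
    rcases (dist_nonneg (x := x a) (y := x b)).eq_or_lt with h | h
    · rw [← h, Real.zero_rpow (by exact_mod_cast hr.ne'), mul_zero] at h3
      exact absurd h3 (not_le.2 (by positivity))
    · exact h
  have hinj : Function.Injective x := by
    intro a b hab
    by_contra h
    have := (hmain a b h).1
    rw [hab, dist_self] at this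
    exact lt_irrefl _ this
  have : Nonempty (Fin N) := ⟨⟨0, by omega⟩⟩
  let f : X → ℝ := fun y => Real.ofDigits (Function.invFun x y)
  have hf : ∀ a, f (x a) = Real.ofDigits a := fun a => by
    simp only [f, Function.leftInverse_invFun hinj a]
  have hhol : HolderOnWith C r f (Set.range x) := by
    rintro _ ⟨a, rfl⟩ _ ⟨b, rfl⟩
    rw [hf, hf]
    by_cases hab : a = b
    · simp [hab]
    have h := (hmain a b hab).2
    rw [edist_dist, edist_dist, Real.dist_eq, ENNReal.ofReal_rpow_of_nonneg dist_nonneg r.coe_nonneg,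
      ← ENNReal.ofReal_coe_nnreal, ← ENNReal.ofReal_mul C.coe_nonneg]
    exact ENNReal.ofReal_le_ofReal h
  have himg : Set.Icc (0 : ℝ) 1 ⊆ f '' Set.range x := by
    intro t ht
    obtain ⟨a, -, ha⟩ := Real.ofDigits_SurjOn (show 1 < N by omega) ht
    exact ⟨x a, ⟨a, rfl⟩, by rw [hf, ha]⟩
  have h1 : (1 : ℝ≥0∞) ≤ dimH (Set.range x) / r := by
    refine le_trans ?_ ((dimH_mono himg).trans (hhol.dimH_image_le hr))
    rw [Real.dimH_of_nonempty_interior (by rw [interior_Icc]; exact ⟨1/2, by norm_num, by norm_num⟩)]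
    simp
  have h2 : (r : ℝ≥0∞) ≤ dimH (Set.range x) := by
    rwa [ENNReal.le_div_iff_mul_le (Or.inl (by exact_mod_cast hr.ne')) (Or.inl ENNReal.coe_ne_top),
      one_mul] at h1
  refine h2.trans (dimH_mono ?_)
  rintro _ ⟨a, rfl⟩
  exact ⟨fun j => (path a j).1, rfl,
    fun j => ⟨(path a j).2, (hc j _ (path a j).2 (a j)).2.1, hx a j⟩⟩

/-! ### Dirichlet's theorem and separation of rational points -/

/-- Dirichlet's theorem on simultaneous approximation. -/
theorem exists_simultaneous_approx {n : ℕ} (x : Fin n → ℝ) {m : ℕ} (hm : 0 < m) :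
    ∃ (q : ℕ) (p : Fin n → ℤ), 0 < q ∧ q ≤ m ^ n ∧ ∀ i, |q * x i - p i| ≤ 1 / m := by
  have hm' : (0 : ℝ) < m := by exact_mod_cast hm
  let f : Fin (m ^ n + 1) → (Fin n → Fin m) := fun k i =>
    ⟨⌊m * Int.fract (k * x i)⌋₊, by
      rw [Nat.floor_lt (by positivity)]
      exact mul_lt_of_lt_one_right hm' (Int.fract_lt_one _)⟩
  obtain ⟨k, l, hkl, h⟩ := Fintype.exists_ne_map_eq_of_card_lt f (by simp)
  wlog hlt : l < k generalizing k l
  · exact this l k hkl.symm h.symm (lt_of_le_of_ne (not_lt.1 hlt) hkl)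
  refine ⟨k - l, fun i => ⌊(k : ℝ) * x i⌋ - ⌊(l : ℝ) * x i⌋, by
    have := Fin.lt_def.1 hlt; omega, by omega, fun i => ?_⟩
  have hle : (l : ℕ) ≤ k := (Fin.lt_def.1 hlt).le
  have h1 := Fin.ext_iff.1 (congrFun h i)
  simp only [f] at h1
  set u := Int.fract ((k : ℝ) * x i) with hu
  set w := Int.fract ((l : ℝ) * x i) with hw
  have hu0 : 0 ≤ m * u := by positivity
  have hw0 : 0 ≤ m * w := by positivity
  have h2 := Nat.floor_le hu0
  have h3 := Nat.lt_floor_add_one (m * u)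
  have h4 := Nat.floor_le hw0
  have h5 := Nat.lt_floor_add_one (m * w)
  rw [h1] at h2 h3
  have h6 : ((k - l : ℕ) : ℝ) * x i - ((⌊(k : ℝ) * x i⌋ - ⌊(l : ℝ) * x i⌋ : ℤ) : ℝ) = u - w := by
    rw [hu, hw, Int.fract, Int.fract]
    push_cast [hle]
    ring
  rw [h6, le_div_iff₀ hm']
  rw [show |u - w| * m = |m * u - m * w| by
    rw [← mul_sub, abs_mul, abs_of_pos hm', mul_comm]]
  rw [abs_le]
  constructor <;> linarith

/-- If all rational points of height at most `X` stay away from `v = p / q`, in the sense that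
`e ≤ ‖q' v - p'‖`, then so do all rational points other than `v`, up to a constant. -/
theorem le_norm_of_height_le {n : ℕ} {X e : ℝ} {J q : ℕ} (hJ : 0 < J) (hq : 0 < q)
    (he1 : e ≤ 1) (hqX : (q : ℝ) ≤ X * (J + 1)) (v : Fin n → ℝ) (p : Fin n → ℤ)
    (hv : ∀ i, q * v i = p i)
    (h : ∀ (q' : ℕ) (p' : Fin n → ℤ), 0 < q' → (q' : ℝ) ≤ X →
      e ≤ ‖fun i => q' * v i - p' i‖)
    (q' : ℕ) (p' : Fin n → ℤ) (hne : ∃ i, q' * v i ≠ p' i) :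
    e ≤ J * ‖fun i => q' * v i - p' i‖ := by
  have hq0 : (0 : ℝ) < q := by exact_mod_cast hq
  -- Dirichlet for `q' / q` brings the height down: `d = k * q' - l * q` has size at most `X`, and
  -- `k * (q' * v - p')` is `d * v` minus an integer vector because `q * v` is integral. The factor
  -- `k ≤ J` is the constant lost.
  obtain ⟨l, k, hk0, hkJ, hkl⟩ := Real.exists_int_int_abs_mul_sub_le ((q' : ℝ) / q) hJ
  have hk0' : (0 : ℝ) < k := by exact_mod_cast hk0
  have hkJ' : (k : ℝ) ≤ J := by exact_mod_cast hkJ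
  have hnk : ‖fun i => (k : ℝ) * (q' * v i - p' i)‖ ≤ J * ‖fun i => q' * v i - p' i‖ := by
    have : (fun i => (k : ℝ) * (q' * v i - p' i)) = (k : ℝ) • fun i => q' * v i - p' i := rfl
    rw [this, norm_smul, Real.norm_of_nonneg hk0'.le]
    gcongr
  refine le_trans ?_ hnk
  set d : ℤ := k * q' - l * q with hd
  have hdX : |(d : ℝ)| ≤ X := by
    have : (d : ℝ) = q * (k * (q' / q) - l) := by
      rw [hd]; push_cast; field_simp
    rw [this, abs_mul, abs_of_pos hq0]
    calc (q : ℝ) * |(k : ℝ) * ((q' : ℝ) / q) - (l : ℝ)| ≤ (X * (J + 1)) * (1 / (J + 1)) :=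
          mul_le_mul hqX hkl (abs_nonneg _) (hq0.le.trans hqX)
      _ = X := by field_simp
  have hkey : ∀ i, (k : ℝ) * (q' * v i - p' i) = d * v i - ((k * p' i - l * p i : ℤ) : ℝ) := by
    intro i
    rw [hd]; push_cast; rw [← hv i]; ring
  rcases lt_trichotomy d 0 with hd0 | hd0 | hd0
  · have h1 := h d.natAbs (fun i => -(k * p' i - l * p i)) (by omega) (by
      rw [Nat.cast_natAbs]; push_cast; exact hdX)
    refine h1.trans (le_of_eq ?_)
    rw [← norm_neg]
    congr 1
    funext i
    have : ((d.natAbs : ℕ) : ℝ) = -d := by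
      rw [Nat.cast_natAbs, abs_of_neg hd0]; push_cast; ring
    simp only [Pi.neg_apply]
    rw [hkey, this]; push_cast; ring
  -- For `d = 0` the vector is integral and nonzero, so its norm is at least `1`.
  · obtain ⟨i, hi⟩ := hne
    refine he1.trans (le_trans ?_ (norm_le_pi_norm _ i))
    have h1 := hkey i
    rw [hd0] at h1
    have h2 : (k : ℝ) * (q' * v i - p' i) ≠ 0 := mul_ne_zero hk0'.ne' (sub_ne_zero.2 hi)
    rw [h1] at h2 ⊢
    simp only [Int.cast_zero, zero_mul, zero_sub, norm_neg, Real.norm_eq_abs] at h2 ⊢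
    rw [← Int.cast_abs]
    have h3 : (k * p' i - l * p i : ℤ) ≠ 0 := by
      intro h0; rw [h0] at h2; simp at h2
    exact_mod_cast Int.one_le_abs h3
  · have h1 := h d.natAbs (fun i => k * p' i - l * p i) (by omega) (by
      rw [Nat.cast_natAbs]; push_cast; exact hdX)
    refine h1.trans (le_of_eq ?_)
    congr 1
    funext i
    have : ((d.natAbs : ℕ) : ℝ) = d := by
      rw [Nat.cast_natAbs, abs_of_pos hd0]
    rw [hkey, this]

/-! ### The simplex lemma -/

/-- A set of vectors which does not lie on an affine hyperplane contains an affine basis. -/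
theorem exists_hyperplane_or_det_ne_zero {n : ℕ} (A : Set (Fin n → ℝ)) :
    (∃ (a : Fin n → ℝ) (b : ℝ), (a ≠ 0 ∨ b ≠ 0) ∧ ∀ v ∈ A, ∑ i, a i * v i + b = 0) ∨
    ∃ v : Fin (n + 1) → Fin n → ℝ, (∀ k, v k ∈ A) ∧
      (Matrix.of fun k => (Fin.cons 1 (v k) : Fin (n + 1) → ℝ)).det ≠ 0 := by
  set s : Set (Fin (n + 1) → ℝ) := (fun v => (Fin.cons 1 v : Fin (n + 1) → ℝ)) '' A with hs
  by_cases htop : Submodule.span ℝ s = ⊤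
  · right
    obtain ⟨f, hfs, -, hli⟩ := Submodule.exists_fun_fin_finrank_span_eq (K := ℝ) s
    have hd : Module.finrank ℝ (Submodule.span ℝ s) = n + 1 := by
      rw [htop, finrank_top, Module.finrank_pi, Fintype.card_fin]
    set g : Fin (n + 1) → Fin (n + 1) → ℝ := fun k => f (Fin.cast hd.symm k) with hg
    have hgli : LinearIndependent ℝ g := hli.comp _ (Fin.cast_injective _)
    have hgs : ∀ k, ∃ v ∈ A, (Fin.cons 1 v : Fin (n + 1) → ℝ) = g k := fun k => hfs _
    choose v hvA hv using hgs
    refine ⟨v, hvA, ?_⟩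
    have : (Matrix.of fun k => (Fin.cons 1 (v k) : Fin (n + 1) → ℝ)) = Matrix.of g := by
      ext k j
      simp only [Matrix.of_apply, hv]
    rw [this]
    have hu : IsUnit (Matrix.of g) := Matrix.linearIndependent_rows_iff_isUnit.1 hgli
    exact ((Matrix.isUnit_iff_isUnit_det _).1 hu).ne_zero
  · left
    obtain ⟨f, hf0, hf⟩ := Submodule.exists_le_ker_of_lt_top _ (lt_top_iff_ne_top.2 htop)
    have hfx : ∀ w, f w = ∑ i, w i * f (fun j => if i = j then 1 else 0) := fun w => by
      rw [LinearMap.pi_apply_eq_sum_univ f w]; rfl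
    refine ⟨fun i => f (fun j => if i.succ = j then 1 else 0), f (fun j => if 0 = j then 1 else 0),
      ?_, fun v hv => ?_⟩
    · by_contra! h
      apply hf0
      ext w
      rw [LinearMap.comp_apply, LinearMap.zero_comp, LinearMap.zero_apply, hfx, Fin.sum_univ_succ,
        h.2, mul_zero, zero_add]
      refine Finset.sum_eq_zero fun i _ => ?_
      have := congrFun h.1 i
      simp only [Pi.zero_apply] at this
      rw [this, mul_zero]
    · have h0 : f (Fin.cons 1 v) = 0 := hf (Submodule.subset_span ⟨v, hv, rfl⟩)
      rw [hfx, Fin.sum_univ_succ] at h0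
      simp only [Fin.cons_zero, Fin.cons_succ, one_mul] at h0
      refine Eq.trans ?_ h0
      rw [add_comm]
      refine congrArg₂ (· + ·) rfl (Finset.sum_congr rfl fun i _ => ?_)
      exact mul_comm (f _) (v i)

/-- Subtracting the first row from the others clears the first column; what remains is an `n × n`
determinant of differences. -/
theorem abs_det_cons_one_le {n : ℕ} (v : Fin (n + 1) → Fin n → ℝ) {d : ℝ}
    (hd : ∀ k l i, |v k i - v l i| ≤ d) :
    |(Matrix.of fun k => (Fin.cons 1 (v k) : Fin (n + 1) → ℝ)).det| ≤ n.factorial * d ^ n := by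
  set B : Matrix (Fin (n + 1)) (Fin (n + 1)) ℝ :=
    Matrix.of fun k => Fin.cases (Fin.cons 1 (v 0) : Fin (n + 1) → ℝ)
      (fun k' => Fin.cons 0 (v k'.succ - v 0)) k with hB
  have h1 : (Matrix.of fun k => (Fin.cons 1 (v k) : Fin (n + 1) → ℝ)).det = B.det := by
    refine Matrix.det_eq_of_forall_row_eq_smul_add_const (Fin.cons 0 fun _ => 1) 0 (by simp) ?_
    intro i j
    refine Fin.cases ?_ (fun i => ?_) i <;> refine Fin.cases ?_ (fun j => ?_) j <;> simp [hB]
  rw [h1, Matrix.det_succ_column_zero, Fin.sum_univ_succ]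
  have h2 : ∀ i : Fin n, B i.succ 0 = 0 := fun i => by simp [hB]
  have h3 : B 0 0 = 1 := by simp [hB]
  simp only [h2, h3, mul_zero, zero_mul, Finset.sum_const_zero, add_zero, Fin.val_zero, pow_zero,
    one_mul]
  have h4 := Matrix.det_le (A := B.submatrix (Fin.succAbove 0) Fin.succ) (abv := AbsoluteValue.abs)
    (x := d) (fun i j => by simpa [hB] using hd i.succ 0 j)
  simpa [nsmul_eq_mul] using h4

/-- The simplex lemma: rational points of small height in a small ball lie on a hyperplane. -/
theorem exists_hyperplane_of_height_le {n : ℕ} (x : Fin n → ℝ) {d X : ℝ}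
    (h : n.factorial * (2 * d) ^ n * X ^ (n + 1) < 1) :
    ∃ (a : Fin n → ℝ) (b : ℝ), (a ≠ 0 ∨ b ≠ 0) ∧ ∀ (q : ℕ) (p : Fin n → ℤ), 0 < q → (q : ℝ) ≤ X →
      ‖(fun i => (p i : ℝ) / q) - x‖ ≤ d → ∑ i, a i * ((p i : ℝ) / q) + b = 0 := by
  rcases exists_hyperplane_or_det_ne_zero
    {v : Fin n → ℝ | ∃ (q : ℕ) (p : Fin n → ℤ), 0 < q ∧ (q : ℝ) ≤ X ∧
      v = (fun i => (p i : ℝ) / q) ∧ ‖v - x‖ ≤ d} with ⟨a, b, hab, hA⟩ | ⟨v, hv, hdet⟩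
  · exact ⟨a, b, hab, fun q p hq hqX hd => hA _ ⟨q, p, hq, hqX, rfl, hd⟩⟩
  · exfalso
    choose q p hq hqX hvp hvx using hv
    set D := (Matrix.of fun k => (Fin.cons 1 (v k) : Fin (n + 1) → ℝ)).det with hD
    have hX : 0 ≤ X := (Nat.cast_nonneg (q 0)).trans (hqX 0)
    have hle : |D| ≤ n.factorial * (2 * d) ^ n := by
      refine abs_det_cons_one_le v fun k l i => ?_
      have h1 := (norm_le_pi_norm _ i).trans (hvx k)
      have h2 := (norm_le_pi_norm _ i).trans (hvx l)
      simp only [Pi.sub_apply, Real.norm_eq_abs] at h1 h2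
      rw [show v k i - v l i = (v k i - x i) - (v l i - x i) by ring]
      exact (abs_sub _ _).trans (by linarith)
    -- Multiplying each row by its denominator gives an integer matrix. Its nonzero determinant is
    -- at least `1` in absolute value, against the volume bound `hle`.
    set Z : Matrix (Fin (n + 1)) (Fin (n + 1)) ℤ :=
      Matrix.of fun k => (Fin.cons (q k : ℤ) (p k) : Fin (n + 1) → ℤ) with hZ
    have hZD : ((Z.det : ℤ) : ℝ) = (∏ k, (q k : ℝ)) * D := by
      rw [hD, ← Matrix.det_mul_column, Int.cast_det]
      congr 1
      ext k j
      have : (q k : ℝ) ≠ 0 := by exact_mod_cast (hq k).ne'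
      refine Fin.cases ?_ (fun j => ?_) j
      · simp [hZ]
      · simp only [hZ, Matrix.map_apply, Matrix.of_apply, Fin.cons_succ]
        rw [hvp]; field_simp
    have hprod : 0 < ∏ k, (q k : ℝ) := Finset.prod_pos fun k _ => by exact_mod_cast hq k
    have hZ0 : Z.det ≠ 0 := by
      intro h0
      rw [h0, Int.cast_zero] at hZD
      exact mul_ne_zero hprod.ne' hdet hZD.symm
    have h1 : (1 : ℝ) ≤ |((Z.det : ℤ) : ℝ)| := by exact_mod_cast Int.one_le_abs hZ0
    rw [hZD, abs_mul, abs_of_pos hprod] at h1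
    have h2 : ∏ k, (q k : ℝ) ≤ X ^ (n + 1) := by
      refine (Finset.prod_le_prod (fun k _ => Nat.cast_nonneg _) fun k _ => hqX k).trans ?_
      simp
    have h3 : (∏ k, (q k : ℝ)) * |D| ≤ X ^ (n + 1) * (n.factorial * (2 * d) ^ n) :=
      mul_le_mul h2 hle (abs_nonneg _) (by positivity)
    nlinarith

/-! ### Grids and hyperplanes -/

/-- The centre of a cell of the partition of the cube of centre `x` and radius `ρ` into `M ^ n`
cubes. -/
noncomputable def gridCentre {n M : ℕ} (x : Fin n → ℝ) (ρ : ℝ) (m : Fin n → Fin M) : Fin n → ℝ :=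
  fun i => x i + ρ * (-1 + (2 * (m i : ℕ) + 1) / M)

theorem norm_gridCentre_sub_le {n M : ℕ} (hM : 0 < M) (x : Fin n → ℝ) {ρ : ℝ} (hρ : 0 ≤ ρ)
    (m : Fin n → Fin M) : ‖gridCentre x ρ m - x‖ ≤ ρ - ρ / M := by
  have hM' : (1 : ℝ) ≤ M := by exact_mod_cast hM
  have h0 : 0 ≤ ρ - ρ / M := by
    rw [sub_nonneg]; exact div_le_self hρ hM'
  rw [pi_norm_le_iff_of_nonneg h0]
  intro i
  have h1 : ((m i : ℕ) : ℝ) + 1 ≤ M := by exact_mod_cast (m i).2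
  have h2 : (0 : ℝ) ≤ ((m i : ℕ) : ℝ) := Nat.cast_nonneg _
  simp only [gridCentre, Pi.sub_apply, add_sub_cancel_left, Real.norm_eq_abs]
  have h3 : ρ - ρ / M = ρ * ((M - 1) / M) := by field_simp
  have h4 : -1 + (2 * ((m i : ℕ) : ℝ) + 1) / M = (2 * (m i : ℕ) + 1 - M) / M := by
    field_simp; ring
  rw [h3, h4, abs_mul, abs_of_nonneg hρ, abs_div, abs_of_pos (by linarith : (0 : ℝ) < M)]
  gcongr
  rw [abs_le]
  constructor <;> linarith

theorem le_norm_gridCentre_sub {n M : ℕ} (hM : 0 < M) (x : Fin n → ℝ) {ρ : ℝ} (hρ : 0 ≤ ρ)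
    {m m' : Fin n → Fin M} (hmm : m ≠ m') :
    2 * ρ / M ≤ ‖gridCentre x ρ m - gridCentre x ρ m'‖ := by
  obtain ⟨i, hi⟩ := Function.ne_iff.1 hmm
  have hM' : (0 : ℝ) < M := by exact_mod_cast hM
  refine le_trans ?_ (norm_le_pi_norm _ i)
  simp only [gridCentre, Pi.sub_apply, Real.norm_eq_abs]
  have h1 : (1 : ℝ) ≤ |((m i : ℕ) : ℝ) - (m' i : ℕ)| := by
    have : ((m i : ℕ) : ℤ) - (m' i : ℕ) ≠ 0 := by
      intro h; apply hi; ext; omega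
    exact_mod_cast Int.one_le_abs this
  rw [show x i + ρ * (-1 + (2 * ((m i : ℕ) : ℝ) + 1) / M) - (x i + ρ * (-1 + (2 * ((m' i : ℕ) : ℝ)
    + 1) / M)) = 2 * ρ / M * (((m i : ℕ) : ℝ) - (m' i : ℕ)) by field_simp; ring, abs_mul,
    abs_of_nonneg (by positivity)]
  exact le_mul_of_one_le_right (by positivity) h1

/-- At least half of the cells of a grid stay away from a given hyperplane. -/
theorem exists_cells_away_from_hyperplane {n M : ℕ} (hn : 1 ≤ n) (hM : 2 * n ≤ M) (x : Fin n → ℝ)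
    {ρ : ℝ} (hρ : 0 < ρ) (a : Fin n → ℝ) (b : ℝ) (hab : a ≠ 0 ∨ b ≠ 0) :
    ∃ G : Finset (Fin n → Fin M), M ^ n ≤ 2 * G.card ∧ ∀ m ∈ G, ∀ y,
      ‖y - gridCentre x ρ m‖ ≤ ρ / (2 * M) → ∀ v : Fin n → ℝ, ∑ i, a i * v i + b = 0 →
      ρ / (2 * M) ≤ ‖y - v‖ := by
  classical
  have hM0 : 0 < M := by omega
  have hMr : (0 : ℝ) < M := by exact_mod_cast hM0
  have : Nonempty (Fin n) := ⟨⟨0, hn⟩⟩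
  obtain ⟨i₀, hi₀⟩ := Finite.exists_max fun i => |a i|
  rcases eq_or_ne (a i₀) 0 with h0 | h0
  · have ha : a = 0 := by
      funext i
      have := hi₀ i
      rw [h0, abs_zero] at this
      exact abs_nonpos_iff.1 this
    refine ⟨Finset.univ, by simpa using Nat.le_mul_of_pos_left _ two_pos, fun m _ y _ v hv => ?_⟩
    simp only [ha, Pi.zero_apply, zero_mul, Finset.sum_const_zero, zero_add] at hv
    rcases hab with h | h
    · exact absurd ha h
    · exact absurd hv h
  have ha0 : 0 < |a i₀| := abs_pos.2 h0
  -- Along a row of cells in direction `i₀` the affine form changes by `2 * ρ / M * |a i₀|` per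
  -- cell, so fewer than `n` steps separate two bad cells and a row has at most `n` of them. In
  -- total at most `n * M ^ (n - 1)` cells are bad, which is at most half since `2 * n ≤ M`.
  set bad : Finset (Fin n → Fin M) := Finset.univ.filter fun m =>
    |∑ i, a i * gridCentre x ρ m i + b| < n * |a i₀| * (ρ / M) with hbad
  have hcard : bad.card ≤ n * M ^ (n - 1) := by
    have h1 := Finset.card_le_mul_card_image_of_maps_to (s := bad)
      (t := (Finset.univ : Finset ({j // j ≠ i₀} → Fin M))) (f := fun m j => m j.1)
      (fun _ _ => Finset.mem_univ _) n ?_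
    · refine h1.trans (le_of_eq ?_)
      simp [Fintype.card_subtype_compl]
    · intro w _
      set F := bad.filter fun m => (fun j : {j // j ≠ i₀} => m j.1) = w with hF
      have hinj : Set.InjOn (fun m : Fin n → Fin M => (m i₀ : ℕ)) F := by
        intro m hm m' hm' h
        simp only [hF, Finset.coe_filter, Set.mem_ofPred_eq] at hm hm'
        funext j
        by_cases hj : j = i₀
        · subst hj; exact Fin.ext h
        · exact congrFun (hm.2.trans hm'.2.symm) ⟨j, hj⟩
      have hclose : ∀ m ∈ F, ∀ m' ∈ F, (m i₀ : ℕ) < (m' i₀ : ℕ) + n := by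
        intro m hm m' hm'
        simp only [hF, hbad, Finset.mem_filter, Finset.mem_univ, true_and] at hm hm'
        have hdiff : (∑ i, a i * gridCentre x ρ m i + b) - (∑ i, a i * gridCentre x ρ m' i + b)
            = a i₀ * (2 * ρ / M * (((m i₀ : ℕ) : ℝ) - (m' i₀ : ℕ))) := by
          rw [add_sub_add_right_eq_sub, ← Finset.sum_sub_distrib, Finset.sum_eq_single i₀]
          · simp only [gridCentre]; field_simp; ring
          · intro j _ hj
            have : m j = m' j := congrFun (hm.2.trans hm'.2.symm) ⟨j, hj⟩
            simp only [gridCentre, this, sub_self]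
          · simp
        have h2 : |a i₀ * (2 * ρ / M * (((m i₀ : ℕ) : ℝ) - (m' i₀ : ℕ)))| <
            2 * (n * |a i₀| * (ρ / M)) := by
          rw [← hdiff]
          exact (abs_sub _ _).trans_lt (by linarith [hm.1, hm'.1])
        have h3 : |a i₀| * (2 * ρ / M) * (((m i₀ : ℕ) : ℝ) - (m' i₀ : ℕ)) <
            |a i₀| * (2 * ρ / M) * n := by
          calc _ ≤ |a i₀ * (2 * ρ / M * (((m i₀ : ℕ) : ℝ) - (m' i₀ : ℕ)))| := by
                rw [abs_mul, mul_assoc]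
                gcongr
                exact le_abs_self _
            _ < _ := h2
            _ = _ := by ring
        have h4 := lt_of_mul_lt_mul_left h3 (by positivity)
        have h5 : ((m i₀ : ℕ) : ℝ) < ((m' i₀ + n : ℕ) : ℝ) := by push_cast; linarith
        exact_mod_cast h5
      rcases F.eq_empty_or_nonempty with hFe | hFne
      · simp [hFe]
      obtain ⟨m₁, hm₁, hmin⟩ := F.exists_min_image (fun m => (m i₀ : ℕ)) hFne
      rw [← Finset.card_image_of_injOn hinj]
      calc (F.image fun m => (m i₀ : ℕ)).card ≤ (Finset.Ico (m₁ i₀ : ℕ) ((m₁ i₀ : ℕ) + n)).card := by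
            refine Finset.card_le_card fun t ht => ?_
            obtain ⟨m, hm, rfl⟩ := Finset.mem_image.1 ht
            exact Finset.mem_Ico.2 ⟨hmin m hm, hclose m hm m₁ hm₁⟩
        _ = n := by simp
  refine ⟨badᶜ, ?_, fun m hm y hy v hv => ?_⟩
  · have h1 : bad.card + badᶜ.card = M ^ n := by
      rw [Finset.card_add_card_compl]; simp
    have h2 : 2 * n * M ^ (n - 1) ≤ M ^ n := by
      calc 2 * n * M ^ (n - 1) ≤ M * M ^ (n - 1) := by gcongr
        _ = M ^ n := by rw [← pow_succ']; congr 1; omega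
    nlinarith
  · by_contra! hlt
    simp only [hbad, Finset.compl_filter, Finset.mem_filter, Finset.mem_univ, true_and,
      not_lt] at hm
    have h1 : ‖gridCentre x ρ m - v‖ < ρ / M := by
      have : ‖gridCentre x ρ m - v‖ ≤ ‖y - gridCentre x ρ m‖ + ‖y - v‖ := by
        rw [show gridCentre x ρ m - v = (y - v) - (y - gridCentre x ρ m) by abel]
        exact (norm_sub_le _ _).trans (by rw [add_comm])
      have h2 : ρ / M = ρ / (2 * M) + ρ / (2 * M) := by field_simp; norm_num
      linarith
    have h2 : ∑ i, a i * gridCentre x ρ m i + b = ∑ i, a i * (gridCentre x ρ m i - v i) := by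
      simp only [mul_sub, Finset.sum_sub_distrib]
      linarith
    rw [h2] at hm
    have h3 : |∑ i, a i * (gridCentre x ρ m i - v i)| ≤ n * (|a i₀| * ‖gridCentre x ρ m - v‖) := by
      refine (Finset.abs_sum_le_sum_abs _ _).trans ?_
      calc ∑ i, |a i * (gridCentre x ρ m i - v i)| ≤
          ∑ _i : Fin n, |a i₀| * ‖gridCentre x ρ m - v‖ := by
            refine Finset.sum_le_sum fun i _ => ?_
            rw [abs_mul]
            exact mul_le_mul (hi₀ i) (norm_le_pi_norm (gridCentre x ρ m - v) i) (abs_nonneg _)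
              (abs_nonneg _)
        _ = _ := by simp
    have hnr : (0 : ℝ) < n := by exact_mod_cast hn
    have h4 : n * (|a i₀| * ‖gridCentre x ρ m - v‖) < n * |a i₀| * (ρ / M) := by
      rw [← mul_assoc]
      gcongr
    linarith

/-! ### Membership in `W(ψ)` and `E(ψ)` -/

/-- Only finitely many rational points of bounded height lie in a given ball. -/
theorem finite_rat_of_height_le {n : ℕ} (x : Fin n → ℝ) (Q : ℕ) (R : ℝ) :
    {v : Fin n → ℚ | ∃ (q : ℕ) (p : Fin n → ℤ), 0 < q ∧ q ≤ Q ∧ (∀ i, v i = (p i : ℚ) / (q : ℚ)) ∧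
      ‖x - fun i => (v i : ℝ)‖ ≤ R}.Finite := by
  set b : ℤ := ⌈(Q : ℝ) * (‖x‖ + R)⌉
  refine (((Set.finite_Iic Q).prod (Set.Finite.pi' fun _ : Fin n => Set.finite_Icc (-b) b)).image
    fun z => fun i => (z.2 i : ℚ) / (z.1 : ℚ)).subset ?_
  rintro v ⟨q, p, hq, hqQ, hv, hR⟩
  refine ⟨(q, p), ⟨hqQ, fun i => ?_⟩, funext fun i => (hv i).symm⟩
  have hq' : (0 : ℝ) < q := by exact_mod_cast hq
  have h1 : |(v i : ℝ)| ≤ ‖x‖ + R := by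
    have h2 := (norm_le_pi_norm (x - fun i => (v i : ℝ)) i).trans hR
    have h3 := norm_le_pi_norm x i
    simp only [Pi.sub_apply, Real.norm_eq_abs] at h2 h3
    have h4 := abs_sub_abs_le_abs_sub (v i : ℝ) (x i)
    rw [abs_sub_comm] at h4
    linarith
  have h5 : |(p i : ℝ)| ≤ (b : ℝ) := by
    have : (p i : ℝ) = q * (v i : ℝ) := by
      rw [hv i]; push_cast; field_simp
    rw [this, abs_mul, abs_of_pos hq']
    refine le_trans ?_ (Int.le_ceil _)
    have h6 : 0 ≤ ‖x‖ + R := (abs_nonneg _).trans h1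
    have : (q : ℝ) ≤ Q := by exact_mod_cast hqQ
    exact mul_le_mul this h1 (abs_nonneg _) (by positivity)
  have h7 : |p i| ≤ b := by exact_mod_cast h5
  exact ⟨(abs_le.1 h7).1, (abs_le.1 h7).2⟩

theorem exists_approx_of_mem_approximableSet {n : ℕ} {ψ : ℕ → ℝ}
    (hmono : ∀ s t : ℕ, 1 ≤ s → s ≤ t → ψ t ≤ ψ s) {x : Fin n → ℝ} (hx : x ∈ approximableSet n ψ)
    (Q : ℕ) : ∃ (q : ℕ) (p : Fin n → ℤ), Q < q ∧ ‖x - fun i => (p i : ℝ) / q‖ < ψ q := by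
  by_contra! h
  refine hx ((finite_rat_of_height_le x Q (ψ 1)).subset ?_)
  rintro v ⟨q, p, hq, hv, hlt⟩
  have hv' : (fun i => (v i : ℝ)) = fun i => (p i : ℝ) / q := by
    funext i; rw [hv i]; push_cast; rfl
  refine ⟨q, p, hq, ?_, hv, hlt.le.trans (hmono 1 q le_rfl hq)⟩
  by_contra! hQ
  rw [hv'] at hlt
  exact absurd hlt (not_lt.2 (h q p hQ))

/-- This passes from pairs `(p, q)` to rational points. One point has infinitely many
representations, so arbitrarily large `q` in `h2` give infinitely many points only because `x` is
not itself rational, which follows from `h1`. -/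
theorem mem_exactApproximableSet {n : ℕ} {ψ : ℕ → ℝ} (hpos : ∀ s : ℕ, 1 ≤ s → 0 < ψ s)
    (hmono : ∀ s t : ℕ, 1 ≤ s → s ≤ t → ψ t ≤ ψ s) (hlim : Tendsto ψ atTop (nhds 0))
    {x : Fin n → ℝ}
    (h1 : ∀ c < (1 : ℝ), ∃ T : ℕ, ∀ (q : ℕ) (p : Fin n → ℤ), T < q →
      c * ψ q ≤ ‖x - fun i => (p i : ℝ) / q‖)
    (h2 : ∀ T : ℕ, ∃ (q : ℕ) (p : Fin n → ℤ), T < q ∧ ‖x - fun i => (p i : ℝ) / q‖ < ψ q) :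
    x ∈ exactApproximableSet n ψ := by
  have hcast : ∀ {v : Fin n → ℚ} {q : ℕ} {p : Fin n → ℤ}, (∀ i, v i = (p i : ℚ) / (q : ℚ)) →
      (fun i => (v i : ℝ)) = fun i => (p i : ℝ) / q := by
    intro v q p hv
    funext i; rw [hv i]; push_cast; rfl
  refine ⟨?_, ?_⟩
  · intro hfin
    have hpt : ∀ v : Fin n → ℚ, (∃ (q : ℕ) (p : Fin n → ℤ), 0 < q ∧
        (∀ i, v i = (p i : ℚ) / (q : ℚ))) → 0 < ‖x - fun i => (v i : ℝ)‖ := by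
      rintro v ⟨q, p, hq, hv⟩
      obtain ⟨T, hT⟩ := h1 (1 / 2) (by norm_num)
      -- Scaling the representation by `T + 1` raises its denominator above `T` without moving the
      -- point.
      have h3 := hT ((T + 1) * q) (fun i => (T + 1) * p i) (by nlinarith)
      have h4 : (fun i => (((T + 1) * p i : ℤ) : ℝ) / (((T + 1) * q : ℕ) : ℝ)) =
          fun i => (v i : ℝ) := by
        rw [hcast hv]
        funext i
        have : (q : ℝ) ≠ 0 := by exact_mod_cast hq.ne'
        push_cast
        field_simp
      rw [h4] at h3
      exact lt_of_lt_of_le (mul_pos (by norm_num) (hpos _ (Nat.mul_pos (by omega) hq))) h3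
    have hev : ∀ᶠ s in atTop, ∀ v ∈ {v : Fin n → ℚ | ∃ (q : ℕ) (p : Fin n → ℤ), 0 < q ∧
        (∀ i, v i = (p i : ℚ) / (q : ℚ)) ∧ ‖x - fun i => (v i : ℝ)‖ < ψ q},
        ψ s < ‖x - fun i => (v i : ℝ)‖ := by
      rw [Set.Finite.eventually_all hfin]
      rintro v ⟨q, p, hq, hv, -⟩
      exact hlim.eventually_lt_const (hpt v ⟨q, p, hq, hv⟩)
    obtain ⟨T, hT⟩ := eventually_atTop.1 hev
    obtain ⟨q, p, hq, hlt⟩ := h2 T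
    have hv : (fun i => (((p i : ℚ) / (q : ℚ) : ℚ) : ℝ)) = fun i => (p i : ℝ) / q := by
      funext i; push_cast; rfl
    have := hT q hq.le (fun i => (p i : ℚ) / (q : ℚ))
      ⟨q, p, by omega, fun _ => rfl, by rw [hv]; exact hlt⟩
    rw [hv] at this
    exact lt_asymm this hlt
  · simp only [Set.mem_iUnion, not_exists]
    intro c hc hx
    obtain ⟨T, hT⟩ := h1 c hc
    refine hx ((finite_rat_of_height_le x T |c * ψ 1|).subset ?_)
    rintro v ⟨q, p, hq, hv, hlt⟩
    refine ⟨q, p, hq, ?_, hv, ?_⟩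
    · by_contra! hTq
      rw [hcast hv] at hlt
      exact absurd hlt (not_lt.2 (hT q p hTq))
    · have hc0 : 0 < c := by
        have := (norm_nonneg _).trans_lt hlt
        exact pos_of_mul_pos_left this (hpos q hq).le
      refine hlt.le.trans (le_trans ?_ (le_abs_self _))
      exact mul_le_mul_of_nonneg_left (hmono 1 q le_rfl hq) hc0.le

/-! ### The upper bound -/

open scoped NNReal in
open MeasureTheory in
/-- The Jarník–Besicovitch upper bound. -/
theorem dimH_approximableSet_le {n : ℕ} {ψ : ℕ → ℝ}
    (hmono : ∀ s t : ℕ, 1 ≤ s → s ≤ t → ψ t ≤ ψ s) {r : ℝ≥0} {L : ℝ} (hr : 0 < r) (hL : 0 < L)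
    (hrL : (n : ℝ) + 1 < r * L) (hψ : ∀ᶠ s : ℕ in atTop, ψ s ≤ (s : ℝ) ^ (-L)) :
    dimH (approximableSet n ψ) ≤ r := by
  obtain ⟨Q₀, hQ₀⟩ := eventually_atTop.1 hψ
  have hcover : approximableSet n ψ =
      ⋃ R : ℕ, approximableSet n ψ ∩ Metric.closedBall 0 R := by
    rw [← Set.inter_iUnion, Metric.iUnion_closedBall_nat, Set.inter_univ]
  rw [hcover, dimH_iUnion]
  refine iSup_le fun R => dimH_le_of_hausdorffMeasure_ne_top (lt_top_iff_ne_top.1 ?_)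
  classical
  -- The cover at step `Q` uses denominators above `Q`. The numerators are cut off at `(R + 1) * q`,
  -- which suffices within radius `R` as soon as `ψ q ≤ 1`.
  let t : ℕ → ℕ × (Fin n → ℤ) → Set (Fin n → ℝ) := fun Q z =>
    if Q < z.1 ∧ Q₀ ≤ z.1 ∧ ∀ i, z.2 i ∈ Finset.Icc (-((R + 1) * z.1 : ℤ)) ((R + 1) * z.1) then
      Metric.ball (fun i => (z.2 i : ℝ) / z.1) (ψ z.1) else ∅
  have hdiam : ∀ (q : ℕ) (w : Fin n → ℝ), Q₀ ≤ q →
      Metric.ediam (Metric.ball w (ψ q)) ≤ ENNReal.ofReal (2 * (q : ℝ) ^ (-L)) := by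
    intro q w hq
    have h1 : Metric.ball w (ψ q) ⊆ Metric.closedBall w ((q : ℝ) ^ (-L)) :=
      (Metric.ball_subset_ball (hQ₀ q hq)).trans Metric.ball_subset_closedBall
    refine Metric.ediam_le_of_forall_dist_le fun a ha b hb => ?_
    have h2 := Metric.mem_closedBall.1 (h1 ha)
    have h3 := Metric.mem_closedBall.1 (h1 hb)
    have := dist_triangle_right a b w
    linarith
  have hmain := Measure.hausdorffMeasure_le_liminf_tsum (r : ℝ)
    (approximableSet n ψ ∩ Metric.closedBall 0 R) (l := atTop)
    (fun Q : ℕ => ENNReal.ofReal (2 * (Q : ℝ) ^ (-L))) ?_ t ?_ ?_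
  · refine hmain.trans_lt ?_
    have hbound : ∀ Q, ∑' z, Metric.ediam (t Q z) ^ (r : ℝ) ≤
        ∑' q : ℕ, ENNReal.ofReal ((2 * (R + 1) + 1) ^ n * 2 ^ (r : ℝ) *
          (q : ℝ) ^ ((n : ℝ) - L * r)) := by
      intro Q
      rw [ENNReal.tsum_prod']
      refine ENNReal.tsum_le_tsum fun q => ?_
      rcases Nat.eq_zero_or_pos q with rfl | hq
      · refine (le_of_eq ?_).trans (zero_le)
        rw [ENNReal.tsum_eq_zero]
        intro p
        simp only [t, Nat.not_lt_zero, false_and, if_false, Metric.ediam_empty]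
        exact ENNReal.zero_rpow_of_pos (by exact_mod_cast hr)
      set F : Finset (Fin n → ℤ) :=
        Fintype.piFinset fun _ => Finset.Icc (-((R + 1) * q : ℤ)) ((R + 1) * q) with hF
      have hq1 : (1 : ℝ) ≤ q := by exact_mod_cast hq
      rw [tsum_eq_sum (s := F)]
      · have hterm : ∀ p ∈ F, Metric.ediam (t Q (q, p)) ^ (r : ℝ) ≤
            ENNReal.ofReal ((2 * (q : ℝ) ^ (-L)) ^ (r : ℝ)) := by
          intro p _
          rw [← ENNReal.ofReal_rpow_of_nonneg (by positivity) r.coe_nonneg]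
          refine ENNReal.rpow_le_rpow ?_ r.coe_nonneg
          simp only [t]
          split_ifs with h
          · exact hdiam q _ h.2.1
          · simp
        refine (Finset.sum_le_card_nsmul _ _ _ hterm).trans ?_
        rw [nsmul_eq_mul, ← ENNReal.ofReal_natCast, ← ENNReal.ofReal_mul (Nat.cast_nonneg _)]
        refine ENNReal.ofReal_le_ofReal ?_
        have hcard : (F.card : ℝ) ≤ ((2 * (R + 1) + 1) * q) ^ n := by
          rw [hF, Fintype.card_piFinset, Finset.prod_const, Finset.card_univ, Fintype.card_fin,
            Int.card_Icc]
          push_cast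
          gcongr
          have : (((((R : ℤ) + 1) * q + 1 - -(((R : ℤ) + 1) * q)).toNat : ℤ) : ℝ) =
              2 * (R + 1) * q + 1 := by
            have h0 : (0 : ℤ) ≤ ((R : ℤ) + 1) * q := by positivity
            rw [Int.toNat_of_nonneg (by linarith)]
            push_cast; ring
          rw [Int.cast_natCast] at this
          rw [this]
          nlinarith
        have hpow : (2 * (q : ℝ) ^ (-L)) ^ (r : ℝ) = 2 ^ (r : ℝ) * (q : ℝ) ^ (-L * r) := by
          rw [Real.mul_rpow (by norm_num) (by positivity), ← Real.rpow_mul (by positivity)]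
        rw [hpow]
        calc (F.card : ℝ) * (2 ^ (r : ℝ) * (q : ℝ) ^ (-L * r))
            ≤ ((2 * (R + 1) + 1) * q) ^ n * (2 ^ (r : ℝ) * (q : ℝ) ^ (-L * r)) := by gcongr
          _ = (2 * (R + 1) + 1) ^ n * 2 ^ (r : ℝ) * ((q : ℝ) ^ (n : ℝ) * (q : ℝ) ^ (-L * r)) := by
            rw [mul_pow, Real.rpow_natCast]; ring
          _ = _ := by
            rw [← Real.rpow_add (by linarith)]
            congr 2
            ring
      · intro p hp
        have : t Q (q, p) = ∅ := by
          simp only [t]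
          rw [if_neg]
          rintro ⟨-, -, h⟩
          exact hp (Fintype.mem_piFinset.2 h)
        rw [this, Metric.ediam_empty]
        exact ENNReal.zero_rpow_of_pos (by exact_mod_cast hr)
    refine (liminf_le_liminf (Eventually.of_forall hbound)).trans_lt ?_
    rw [liminf_const, lt_top_iff_ne_top]
    refine Summable.tsum_ofReal_ne_top (Summable.mul_left _ ?_)
    rw [Real.summable_nat_rpow]
    linarith
  · have h1 : Tendsto (fun Q : ℕ => 2 * (Q : ℝ) ^ (-L)) atTop (nhds (2 * 0)) :=
      ((tendsto_rpow_neg_atTop hL).comp tendsto_natCast_atTop_atTop).const_mul 2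
    have := ENNReal.tendsto_ofReal h1
    simpa using this
  · filter_upwards [eventually_ge_atTop 1] with Q hQ z
    simp only [t]
    split_ifs with h
    · refine (hdiam _ _ h.2.1).trans (ENNReal.ofReal_le_ofReal ?_)
      have hQ' : (0 : ℝ) < Q := by exact_mod_cast hQ
      have : (Q : ℝ) ≤ z.1 := by exact_mod_cast h.1.le
      exact mul_le_mul_of_nonneg_left
        (Real.rpow_le_rpow_of_nonpos hQ' this (by linarith)) (by norm_num)
    · simp
  · filter_upwards [eventually_ge_atTop (Q₀ + 1)] with Q hQ x hx
    obtain ⟨q, p, hq, hlt⟩ := exists_approx_of_mem_approximableSet hmono hx.1 Q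
    refine Set.mem_iUnion.2 ⟨(q, p), ?_⟩
    have hq' : (1 : ℝ) ≤ q := by exact_mod_cast (by omega : 1 ≤ q)
    simp only [t]
    rw [if_pos, Metric.mem_ball, dist_eq_norm]
    · exact hlt
    · refine ⟨hq, by omega, fun i => ?_⟩
      have h1 := (norm_le_pi_norm _ i).trans hlt.le
      have h2 := (norm_le_pi_norm x i).trans (by simpa using hx.2)
      simp only [Pi.sub_apply, Real.norm_eq_abs] at h1 h2
      have h3 : ψ q ≤ 1 :=
        (hQ₀ q (by omega)).trans (Real.rpow_le_one_of_one_le_of_nonpos hq' (by linarith))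
      have h4 : |(p i : ℝ) / q| ≤ R + 1 := by
        have := abs_sub_abs_le_abs_sub ((p i : ℝ) / q) (x i)
        rw [abs_sub_comm] at this
        linarith
      rw [abs_div, abs_of_pos (by linarith : (0 : ℝ) < q), div_le_iff₀ (by linarith)] at h4
      have h5 : |p i| ≤ (R + 1) * q := by exact_mod_cast h4
      rw [Finset.mem_Icc]
      exact abs_le.1 h5

/-! ### Badly approximable cubes -/

/-- The rational point `p / q` of `ℝⁿ`. -/
noncomputable def ratPoint {n : ℕ} (q : ℕ) (p : Fin n → ℤ) : Fin n → ℝ := fun i => (p i : ℝ) / q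

theorem norm_mul_sub_eq {n : ℕ} {q : ℕ} (hq : 0 < q) (y : Fin n → ℝ) (p : Fin n → ℤ) :
    ‖fun i => q * y i - p i‖ = q * ‖y - ratPoint q p‖ := by
  have hq' : (0 : ℝ) < q := by exact_mod_cast hq
  have : (fun i => q * y i - p i) = (q : ℝ) • (y - ratPoint q p) := by
    funext i
    simp only [ratPoint, Pi.smul_apply, Pi.sub_apply, smul_eq_mul]
    field_simp
  rw [this, norm_smul, Real.norm_of_nonneg hq'.le]

/-- All points of the cube of centre `x` and radius `ρ` are badly approximable by the rational
points with denominator `q > T`, as far as the scale `ρ` can see. -/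
def BadlyApproximableOn {n : ℕ} (α κ η : ℝ) (T : ℕ) (x : Fin n → ℝ) (ρ : ℝ) : Prop :=
  ∀ y, ‖y - x‖ ≤ ρ → ∀ (q : ℕ) (p : Fin n → ℤ), T < q → (q : ℝ) ^ α * ρ ≤ κ →
    η ≤ (q : ℝ) ^ α * ‖y - ratPoint q p‖

/-- Shrinking the cube by `2 * M` brings into view only the heights with `κ < q ^ α * ρ ≤ 2 * M *
κ`. Their points near the cube lie on one hyperplane, and a cell avoiding it is at distance `ρ / (2
* M)`, which gives the constant `κ / (2 * M)` again: nothing is lost in the iteration. -/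
theorem BadlyApproximableOn.exists_children {n M T : ℕ} (hn : 1 ≤ n) (hM : 2 * n ≤ M)
    {x : Fin n → ℝ} {ρ α κ : ℝ} (hα : α = ((n : ℝ) + 1) / n) (hρ : 0 < ρ) (hκ : 0 < κ)
    (hκn : n.factorial * (4 * (2 * M * κ)) ^ n < 1)
    (h : BadlyApproximableOn α κ (κ / (2 * M)) T x ρ) :
    ∃ c : Fin (M ^ n / 2) → Fin n → ℝ,
      (∀ i, ‖c i - x‖ ≤ ρ - ρ / M ∧ BadlyApproximableOn α κ (κ / (2 * M)) T (c i) (ρ / (2 * M))) ∧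
      ∀ i i', i ≠ i' → 2 * ρ / M ≤ ‖c i - c i'‖ := by
  have hM0 : 0 < M := by omega
  have hMr : (2 : ℝ) ≤ M := by exact_mod_cast (by omega : 2 ≤ M)
  have hnr : (0 : ℝ) < n := by exact_mod_cast hn
  have hα0 : 0 < α := by rw [hα]; positivity
  set X : ℝ := (2 * M * κ / ρ) ^ α⁻¹ with hX
  have hX0 : 0 < X := by positivity
  have hXα : X ^ α = 2 * M * κ / ρ := by
    rw [hX, Real.rpow_inv_rpow (by positivity) hα0.ne']
  have hXn : X ^ (n + 1) = (2 * M * κ / ρ) ^ n := by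
    rw [← hXα, ← Real.rpow_natCast, ← Real.rpow_natCast, ← Real.rpow_mul hX0.le, hα]
    congr 1
    push_cast
    field_simp
  -- Since `X ^ (n + 1) = (2 * M * κ / ρ) ^ n`, the radius cancels and the simplex condition becomes
  -- `hκn`.
  obtain ⟨a, b, hab, hyp⟩ := exists_hyperplane_of_height_le x (d := 2 * ρ) (X := X) (by
    rw [hXn, mul_assoc, ← mul_pow]
    convert hκn using 3
    field_simp; norm_num)
  obtain ⟨G, hG, hcell⟩ := exists_cells_away_from_hyperplane hn hM x hρ a b hab
  have hGcard : M ^ n / 2 ≤ G.card := by omega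
  let c : Fin (M ^ n / 2) → Fin n → Fin M := fun i => (G.equivFin.symm (Fin.castLE hGcard i)).1
  have hcinj : Function.Injective c := fun i j hij =>
    Fin.castLE_injective hGcard (G.equivFin.symm.injective (Subtype.ext hij))
  have hcG : ∀ i, c i ∈ G := fun i => (G.equivFin.symm (Fin.castLE hGcard i)).2
  refine ⟨fun i => gridCentre x ρ (c i), fun i => ⟨norm_gridCentre_sub_le hM0 x hρ.le _, ?_⟩,
    fun i i' hii => le_norm_gridCentre_sub hM0 x hρ.le (hcinj.ne hii)⟩
  intro y hy q p hq hqκ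
  have hdiv : ρ / (2 * M) ≤ ρ / M := by
    gcongr
    linarith
  have hyx : ‖y - x‖ ≤ ρ := by
    have h1 := norm_gridCentre_sub_le hM0 x hρ.le (c i)
    have h2 := norm_add_le (y - gridCentre x ρ (c i)) (gridCentre x ρ (c i) - x)
    rw [sub_add_sub_cancel] at h2
    linarith
  have hq0 : 0 < q := by omega
  have hqr : (0 : ℝ) < q := by exact_mod_cast hq0
  by_cases hold : (q : ℝ) ^ α * ρ ≤ κ
  · exact h y hyx q p hq hold
  have hqX : (q : ℝ) ≤ X := by
    rw [← Real.rpow_le_rpow_iff hqr.le hX0.le hα0, hXα, le_div_iff₀ hρ]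
    calc (q : ℝ) ^ α * ρ = (q : ℝ) ^ α * (ρ / (2 * M)) * (2 * M) := by field_simp
      _ ≤ κ * (2 * M) := by gcongr
      _ = 2 * M * κ := by ring
  have hdist : ρ / (2 * M) ≤ ‖y - ratPoint q p‖ := by
    by_cases hv : ‖ratPoint q p - x‖ ≤ 2 * ρ
    · exact hcell _ (hcG i) y hy _ (hyp q p hq0 hqX hv)
    · have h1 := norm_add_le (ratPoint q p - y) (y - x)
      rw [sub_add_sub_cancel, norm_sub_rev (ratPoint q p) y] at h1
      have h2 : ρ / (2 * M) ≤ ρ := div_le_self hρ.le (by linarith)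
      linarith
  calc κ / (2 * M) ≤ (q : ℝ) ^ α * ρ / (2 * M) := by
        gcongr
        exact (not_le.1 hold).le
    _ = (q : ℝ) ^ α * (ρ / (2 * M)) := by ring
    _ ≤ _ := by gcongr

theorem mul_rpow_neg_add_one {n : ℕ} (hn : 1 ≤ n) {α : ℝ} (hα : α = ((n : ℝ) + 1) / n) {t : ℝ}
    (ht : 0 < t) : t * t ^ (-α) = t ^ (-(1 / n : ℝ)) := by
  have hnr : (0 : ℝ) < n := by exact_mod_cast hn
  have hα1 : α = 1 + 1 / n := by rw [hα]; field_simp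
  rw [hα1, show (-(1 / n : ℝ)) = 1 + -(1 + 1 / n) by ring, Real.rpow_add ht, Real.rpow_one]

/-- Combines bad approximability for `q > T` with the cruder bound `τ` for `q ≤ T`; `X` is the
largest height visible at scale `ρ`. -/
theorem BadlyApproximableOn.le_norm_mul_sub {n T : ℕ} {α κ η ρ τ X : ℝ} {x : Fin n → ℝ}
    (hn : 1 ≤ n) (hα : α = ((n : ℝ) + 1) / n) (hη : 0 < η) (hρ : 0 < ρ) (hX : X ^ α * ρ = κ)
    (hX1 : 1 ≤ X) (h : BadlyApproximableOn α κ η T x ρ)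
    (hτ : ∀ y, ‖y - x‖ ≤ ρ → ∀ (q : ℕ) (p : Fin n → ℤ), 0 < q → q ≤ T → τ ≤ ‖y - ratPoint q p‖)
    (hXτ : η * X ^ (-(1 / n : ℝ)) ≤ τ) {y : Fin n → ℝ} (hy : ‖y - x‖ ≤ ρ) {q : ℕ}
    (p : Fin n → ℤ) (hq : 0 < q) (hqX : (q : ℝ) ≤ X) :
    η * X ^ (-(1 / n : ℝ)) ≤ ‖fun i => q * y i - p i‖ := by
  have hnr : (0 : ℝ) < n := by exact_mod_cast hn
  have hα0 : 0 < α := by rw [hα]; positivity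
  have hX0 : 0 < X := by linarith
  have hqr : (1 : ℝ) ≤ q := by exact_mod_cast hq
  rw [norm_mul_sub_eq hq]
  rcases le_or_gt q T with hqT | hqT
  · have h1 := hXτ.trans (hτ y hy q p hq hqT)
    exact h1.trans (le_mul_of_one_le_left (norm_nonneg _) hqr)
  · have hqκ : (q : ℝ) ^ α * ρ ≤ κ := by rw [← hX]; gcongr
    have h1 := h y hy q p hqT hqκ
    have hq0 : (0 : ℝ) < q := by linarith
    calc η * X ^ (-(1 / n : ℝ)) ≤ η * (q : ℝ) ^ (-(1 / n : ℝ)) := by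
          exact mul_le_mul_of_nonneg_left (Real.rpow_le_rpow_of_nonpos hq0 hqX
            (by rw [neg_nonpos]; positivity)) hη.le
      _ ≤ (q : ℝ) ^ α * ‖y - ratPoint q p‖ * (q : ℝ) ^ (-(1 / n : ℝ)) := by gcongr
      _ = (q : ℝ) ^ α * (q : ℝ) ^ (-α) * q * ‖y - ratPoint q p‖ := by
          rw [← mul_rpow_neg_add_one hn hα hq0]; ring
      _ = q * ‖y - ratPoint q p‖ := by
          rw [← Real.rpow_add hq0, add_neg_cancel, Real.rpow_zero, one_mul]

/-- A cube whose points are far from the rational points of height at most `X` contains a rational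
point of height comparable to `X`. -/
theorem exists_ratPoint_of_le_norm {n : ℕ} (hn : 1 ≤ n) {α κ η ρ X : ℝ} {x : Fin n → ℝ}
    (hα : α = ((n : ℝ) + 1) / n) (hη : 0 < η) (hη1 : η ≤ 1) (hηκ : 2 * η ≤ κ) (hρ : 0 < ρ)
    (hX : X ^ α * ρ = κ) (hX1 : 1 ≤ X)
    (hfar : ∀ y, ‖y - x‖ ≤ ρ → ∀ (q : ℕ) (p : Fin n → ℤ), 0 < q → (q : ℝ) ≤ X →
      η * X ^ (-(1 / n : ℝ)) ≤ ‖fun i => q * y i - p i‖) :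
    ∃ (q : ℕ) (p : Fin n → ℤ), X < q ∧ (q : ℝ) ≤ (2 / η) ^ n * X ∧ ‖ratPoint q p - x‖ ≤ ρ / 2 ∧
      ∀ (q' : ℕ) (p' : Fin n → ℤ), 0 < q' → ratPoint q' p' = ratPoint q p → q ≤ q' := by
  have hnr : (0 : ℝ) < n := by exact_mod_cast hn
  have hα0 : 0 < α := by rw [hα]; positivity
  have hX0 : 0 < X := by linarith
  have hκ : 0 < κ := by linarith
  set e : ℝ := η * X ^ (-(1 / n : ℝ)) with he
  have he0 : 0 < e := by positivity
  have he1 : e ≤ 1 := mul_le_one₀ hη1 (by positivity)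
    (Real.rpow_le_one_of_one_le_of_nonpos hX1 (by rw [neg_nonpos]; positivity))
  have hpow : ∀ t : ℝ, 0 < t → t * t ^ (-α) = t ^ (-(1 / n : ℝ)) := fun t ht =>
    mul_rpow_neg_add_one hn hα ht
  have hxx : ‖x - x‖ ≤ ρ := by simpa using hρ.le
  -- Chosen so that `1 / m < e`: the Dirichlet denominator then cannot be at most `X`, yet it is at
  -- most `m ^ n ≤ (2 / e) ^ n`, a constant times `X`.
  set m : ℕ := ⌊e⁻¹⌋₊ + 1 with hm
  have hm1 : e⁻¹ < m := by rw [hm]; push_cast; exact Nat.lt_floor_add_one _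
  have hm0 : (0 : ℝ) < m := (by positivity : (0:ℝ) < e⁻¹).trans hm1
  have hm2 : (m : ℝ) ≤ 2 * e⁻¹ := by
    have h1 : (1 : ℝ) ≤ e⁻¹ := (one_le_inv₀ he0).2 he1
    have h2 := Nat.floor_le (by positivity : 0 ≤ e⁻¹)
    rw [hm]; push_cast; linarith
  have hme : 1 / (m : ℝ) < e := by
    rw [one_div]; exact inv_lt_of_inv_lt₀ he0 hm1
  obtain ⟨q₀, p₀, hq₀, hq₀m, happ⟩ := exists_simultaneous_approx x (m := m) (by omega)
  have happ' : ‖fun i => q₀ * x i - p₀ i‖ ≤ 1 / m :=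
    (pi_norm_le_iff_of_nonneg (by positivity)).2 happ
  have hq₀X : X < q₀ := by
    by_contra! hle
    linarith [hfar x hxx q₀ p₀ hq₀ hle]
  have hq₀r : (0 : ℝ) < q₀ := by exact_mod_cast hq₀
  have hq₀K : (q₀ : ℝ) ≤ (2 / η) ^ n * X := by
    have h1 : (q₀ : ℝ) ≤ (m : ℝ) ^ n := by exact_mod_cast hq₀m
    refine h1.trans ?_
    calc (m : ℝ) ^ n ≤ (2 * e⁻¹) ^ n := by gcongr
      _ = (2 / η) ^ n * (X ^ (1 / n : ℝ)) ^ n := by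
        rw [he, mul_inv, ← Real.rpow_neg hX0.le, neg_neg, ← mul_pow]
        ring
      _ = (2 / η) ^ n * X := by
        rw [← Real.rpow_natCast (X ^ _), ← Real.rpow_mul hX0.le, one_div,
          inv_mul_cancel₀ hnr.ne', Real.rpow_one]
  set v := ratPoint q₀ p₀ with hv
  have hvx : ‖v - x‖ ≤ ρ / 2 := by
    rw [norm_sub_rev]
    rw [norm_mul_sub_eq hq₀] at happ'
    have h1 : (q₀ : ℝ) * ‖x - v‖ ≤ e := happ'.trans hme.le
    have h2 : X * ‖x - v‖ ≤ e :=
      (mul_le_mul_of_nonneg_right hq₀X.le (norm_nonneg _)).trans h1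
    have h3 : e = X * (η * X ^ (-α)) := by rw [he, ← hpow X hX0]; ring
    rw [h3] at h2
    have h4 := le_of_mul_le_mul_left h2 hX0
    have h5 : X ^ (-α) = ρ / κ := by
      rw [Real.rpow_neg hX0.le, ← hX]; field_simp
    rw [h5] at h4
    refine h4.trans ?_
    rw [mul_div_assoc', div_le_div_iff₀ hκ two_pos]
    nlinarith
  -- The least denominator of `v` is taken so that every other representation `q'` has `ψ q' ≤ ψ q`.
  -- It still exceeds `X`, as `hfar` at `v` itself shows.
  have hex : ∃ q : ℕ, 0 < q ∧ ∃ p : Fin n → ℤ, ratPoint q p = v := ⟨q₀, hq₀, p₀, rfl⟩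
  classical
  obtain ⟨hq, p, hp⟩ := Nat.find_spec hex
  have hqle : Nat.find hex ≤ q₀ := Nat.find_min' hex ⟨hq₀, p₀, rfl⟩
  have hqmin : ∀ q' : ℕ, 0 < q' → ∀ p' : Fin n → ℤ, ratPoint q' p' = v → Nat.find hex ≤ q' :=
    fun q' hq' p' hp' => Nat.find_min' hex ⟨hq', p', hp'⟩
  generalize Nat.find hex = q at hq p hp hqle hqmin
  have hqr : (0 : ℝ) < q := by exact_mod_cast hq
  have hvρ : ‖v - x‖ ≤ ρ := by linarith
  have hqX : X < q := by
    by_contra! hle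
    have h1 := hfar v hvρ q p hq hle
    rw [norm_mul_sub_eq hq, hp, sub_self, norm_zero, mul_zero] at h1
    linarith
  have hqK : (q : ℝ) ≤ (2 / η) ^ n * X := le_trans (by exact_mod_cast hqle) hq₀K
  exact ⟨q, p, hqX, hqK, hp ▸ hvx, fun q' p' hq' hp' => hqmin q' hq' p' (hp'.trans hp)⟩

/-! ### The shell around a rational point -/

/-- In a cube of badly approximable points of scale `X` there is a cube of exactly approximable
points, near a rational point with denominator comparable to `X`. -/
theorem BadlyApproximableOn.exists_shell {n T J : ℕ} (hn : 1 ≤ n) {ψ : ℕ → ℝ}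
    (hpos : ∀ s : ℕ, 1 ≤ s → 0 < ψ s) (hmono : ∀ s t : ℕ, 1 ≤ s → s ≤ t → ψ t ≤ ψ s)
    {α κ η ρ τ ε δ X : ℝ} {x : Fin n → ℝ} (hα : α = ((n : ℝ) + 1) / n) (hη : 0 < η)
    (hη1 : η ≤ 1) (hηκ : 2 * η ≤ κ) (hρ : 0 < ρ) (hX : X ^ α * ρ = κ) (hX1 : 1 ≤ X)
    (h : BadlyApproximableOn α κ η T x ρ)
    (hτ : ∀ y, ‖y - x‖ ≤ ρ → ∀ (q : ℕ) (p : Fin n → ℤ), 0 < q → q ≤ T → τ ≤ ‖y - ratPoint q p‖)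
    (hXτ : η * X ^ (-(1 / n : ℝ)) ≤ τ) (hJ : (2 / η) ^ n ≤ (J : ℝ) + 1)
    (hε : 0 < ε) (hε1 : ε < 1) (hδ : 0 < δ) (hδκ : 2 * δ ≤ κ) (hδη : δ ≤ η / (2 * J))
    (hδε : 4 * κ * δ ^ (1 / n : ℝ) ≤ ε * (η / (2 * J)) ^ α)
    (hψX : ∀ t : ℕ, X < t → ψ t ≤ δ * (t : ℝ) ^ (-α)) :
    ∃ (q : ℕ) (p : Fin n → ℤ) (x' : Fin n → ℝ), X < q ∧ (q : ℝ) ≤ (2 / η) ^ n * X ∧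
      ‖x' - x‖ + ε / 4 * ψ q ≤ ρ ∧ ∀ y, ‖y - x'‖ ≤ ε / 4 * ψ q → ‖y - ratPoint q p‖ < ψ q ∧
        ∀ (q' : ℕ) (p' : Fin n → ℤ), T < q' → (q' : ℝ) ^ α * (ε / 4 * ψ q) ≤ κ →
          (1 - ε) * min (ψ q') (η * (q' : ℝ) ^ (-α)) ≤ ‖y - ratPoint q' p'‖ := by
  have hnr : (0 : ℝ) < n := by exact_mod_cast hn
  have hα1 : α = 1 + 1 / n := by rw [hα]; field_simp
  have hα0 : 0 < α := by rw [hα]; positivity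
  have hX0 : 0 < X := by linarith
  have hκ : 0 < κ := by linarith
  set e : ℝ := η * X ^ (-(1 / n : ℝ)) with he
  have he0 : 0 < e := by positivity
  have he1 : e ≤ 1 := mul_le_one₀ hη1 (by positivity)
    (Real.rpow_le_one_of_one_le_of_nonpos hX1 (by rw [neg_nonpos]; positivity))
  have hpow : ∀ t : ℝ, 0 < t → t * t ^ (-α) = t ^ (-(1 / n : ℝ)) := fun t ht =>
    mul_rpow_neg_add_one hn hα ht
  have hpowX : ∀ t : ℝ, X ≤ t → t ^ (-(1 / n : ℝ)) ≤ X ^ (-(1 / n : ℝ)) := fun t ht =>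
    Real.rpow_le_rpow_of_nonpos hX0 ht (by rw [neg_nonpos]; positivity)
  have hfar : ∀ y, ‖y - x‖ ≤ ρ → ∀ (q : ℕ) (p : Fin n → ℤ), 0 < q → (q : ℝ) ≤ X →
      e ≤ ‖fun i => q * y i - p i‖ := fun y hy q p hq hqX =>
    h.le_norm_mul_sub hn hα hη hρ hX hX1 hτ hXτ hy p hq hqX
  obtain ⟨q, p, hqX, hqK, hvx, hqmin⟩ :=
    exists_ratPoint_of_le_norm hn hα hη hη1 hηκ hρ hX hX1 hfar
  have hqr : (0 : ℝ) < q := by linarith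
  have hq : 0 < q := by exact_mod_cast hqr
  obtain ⟨v, hp⟩ : ∃ v, ratPoint q p = v := ⟨_, rfl⟩
  rw [hp] at hvx
  simp only [hp] at hqmin
  have hvρ : ‖v - x‖ ≤ ρ := by linarith
  have hψq := hpos q hq
  have hψqρ : ψ q ≤ ρ / 2 := by
    have h1 : (q : ℝ) ^ (-α) ≤ X ^ (-α) :=
      Real.rpow_le_rpow_of_nonpos hX0 hqX.le (by linarith)
    have h5 : X ^ (-α) = ρ / κ := by
      rw [Real.rpow_neg hX0.le, ← hX]; field_simp
    calc ψ q ≤ δ * (q : ℝ) ^ (-α) := hψX q hqX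
      _ ≤ δ * (ρ / κ) := by rw [← h5]; gcongr
      _ ≤ ρ / 2 := by
        rw [mul_div_assoc', div_le_div_iff₀ hκ two_pos]
        nlinarith
  have hJ0 : 0 < J := by
    by_contra! hJ0
    have : J = 0 := by omega
    rw [this, Nat.cast_zero, zero_add] at hJ
    have h2 : (1 : ℝ) < 2 / η := by rw [lt_div_iff₀ hη]; linarith
    exact absurd hJ (not_le.2 (one_lt_pow₀ h2 (by omega)))
  have hJr : (0 : ℝ) < J := by exact_mod_cast hJ0
  have hsep := le_norm_of_height_le hJ0 hq he1
    (hqK.trans (by rw [mul_comm]; exact mul_le_mul_of_nonneg_left hJ hX0.le)) v p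
    (fun i => by rw [← hp, ratPoint]; field_simp) (hfar v hvρ)
  have : Nonempty (Fin n) := ⟨⟨0, hn⟩⟩
  -- In the sup norm this centre is at distance exactly `(1 - ε / 2) * ψ q` from `v`, so the cube of
  -- radius `ε / 4 * ψ q` stays strictly inside the shell.
  refine ⟨q, p, v + fun _ => (1 - ε / 2) * ψ q, hqX, hqK, ?_, fun y hy => ?_⟩
  · have h1 : ‖v + (fun _ => (1 - ε / 2) * ψ q) - x‖ ≤ ‖v - x‖ + (1 - ε / 2) * ψ q := by
      rw [add_sub_right_comm]
      refine (norm_add_le _ _).trans ?_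
      rw [pi_norm_const, Real.norm_of_nonneg (mul_nonneg (by linarith) hψq.le)]
    nlinarith
  rw [hp]
  have hw : ‖(v + fun _ => (1 - ε / 2) * ψ q) - v‖ = (1 - ε / 2) * ψ q := by
    rw [add_sub_cancel_left, pi_norm_const,
      Real.norm_of_nonneg (mul_nonneg (by linarith) hψq.le)]
  set x' : Fin n → ℝ := v + fun _ => (1 - ε / 2) * ψ q with hx'
  have hup : ‖y - v‖ < ψ q := by
    have h1 := norm_add_le (y - x') (x' - v)
    rw [sub_add_sub_cancel, hw] at h1
    nlinarith
  have hlow : (1 - ε) * ψ q ≤ ‖y - v‖ := by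
    have h1 := norm_sub_le (y - v) (y - x')
    rw [sub_sub_sub_cancel_left, hw] at h1
    nlinarith
  have hyx : ‖y - x‖ ≤ ρ := by
    have h1 := norm_add_le (y - v) (v - x)
    rw [sub_add_sub_cancel] at h1
    linarith
  refine ⟨hup, fun q' p' hq'T hq'κ => ?_⟩
  have hq' : 0 < q' := by omega
  have hq'r : (0 : ℝ) < q' := by exact_mod_cast hq'
  have hψq' := hpos q' hq'
  by_cases hpv : ratPoint q' p' = v
  · rw [hpv]
    refine le_trans ?_ hlow
    exact mul_le_mul_of_nonneg_left ((min_le_left _ _).trans (hmono q q' hq (hqmin q' p' hq' hpv)))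
      (by linarith)
  have hmin0 : 0 ≤ min (ψ q') (η * (q' : ℝ) ^ (-α)) := le_min hψq'.le (by positivity)
  refine le_trans (mul_le_of_le_one_left hmin0 (by linarith)) ?_
  rcases le_or_gt (q' : ℝ) X with hq'X | hq'X
  · have h1 := h y hyx q' p' hq'T (by rw [← hX]; gcongr)
    calc min (ψ q') (η * (q' : ℝ) ^ (-α)) ≤ η * (q' : ℝ) ^ (-α) := min_le_right _ _
      _ ≤ (q' : ℝ) ^ α * ‖y - ratPoint q' p'‖ * (q' : ℝ) ^ (-α) := by gcongr
      _ = (q' : ℝ) ^ α * (q' : ℝ) ^ (-α) * ‖y - ratPoint q' p'‖ := by ring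
      _ = ‖y - ratPoint q' p'‖ := by
        rw [← Real.rpow_add hq'r, add_neg_cancel, Real.rpow_zero, one_mul]
  · refine (min_le_left _ _).trans ?_
    have hne : ∃ i, q' * v i ≠ p' i := by
      by_contra! hall
      apply hpv
      funext i
      rw [ratPoint, ← hall i]; field_simp
    have h1 := hsep q' p' hne
    rw [norm_mul_sub_eq hq'] at h1
    -- After scaling by `q'`, the other point is at least `2 * e'` from `v`, while `y` is at most
    -- `q' * ψ q ≤ e'` from `v`. This leaves `e' ≥ q' * ψ q'`.
    set e' : ℝ := η / (2 * J) * X ^ (-(1 / n : ℝ)) with he'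
    have hee : e = J * (2 * e') := by rw [he, he']; field_simp
    rw [hee] at h1
    have h2 := le_of_mul_le_mul_left h1 hJr
    have h3 : (q' : ℝ) * ψ q' ≤ e' := by
      calc (q' : ℝ) * ψ q' ≤ q' * (δ * (q' : ℝ) ^ (-α)) := by
            gcongr
            exact hψX q' hq'X
        _ = δ * (q' : ℝ) ^ (-(1 / n : ℝ)) := by rw [← hpow q' hq'r]; ring
        _ ≤ e' := by
            rw [he']
            exact mul_le_mul hδη (hpowX q' hq'X.le) (by positivity) (by positivity)
    -- Raised to the power `α = 1 + 1 / n`, the left side splits into `q' ^ α * ψ q`, bounded by the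
    -- visible range of heights, and `ψ q ^ (1 / n)`, made small by `δ`.
    have h4 : (q' : ℝ) * ψ q ≤ e' := by
      have he'0 : 0 ≤ e' := by positivity
      rw [← Real.rpow_le_rpow_iff (by positivity) he'0 hα0]
      have h5 : ψ q ^ (1 / n : ℝ) ≤ δ ^ (1 / n : ℝ) * (X ^ (-(1 / n : ℝ))) ^ α := by
        calc ψ q ^ (1 / n : ℝ) ≤ (δ * X ^ (-α)) ^ (1 / n : ℝ) := by
              refine Real.rpow_le_rpow hψq.le ((hψX q hqX).trans ?_) (by positivity)
              exact mul_le_mul_of_nonneg_left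
                (Real.rpow_le_rpow_of_nonpos hX0 hqX.le (by linarith)) hδ.le
          _ = _ := by
              rw [Real.mul_rpow hδ.le (by positivity), ← Real.rpow_mul hX0.le,
                ← Real.rpow_mul hX0.le]
              congr 2; ring
      have h6 : (q' : ℝ) ^ α * ψ q ≤ 4 * κ / ε := by
        rw [le_div_iff₀ hε]; linarith
      calc ((q' : ℝ) * ψ q) ^ α = (q' : ℝ) ^ α * ψ q * ψ q ^ (1 / n : ℝ) := by
            rw [Real.mul_rpow hq'r.le hψq.le, hα1, Real.rpow_add hψq, Real.rpow_one]; ring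
        _ ≤ 4 * κ / ε * (δ ^ (1 / n : ℝ) * (X ^ (-(1 / n : ℝ))) ^ α) := by gcongr
        _ = (4 * κ * δ ^ (1 / n : ℝ)) / ε * (X ^ (-(1 / n : ℝ))) ^ α := by ring
        _ ≤ (η / (2 * J)) ^ α * (X ^ (-(1 / n : ℝ))) ^ α := by
            gcongr
            rw [div_le_iff₀ hε]; linarith
        _ = e' ^ α := by
            rw [he', Real.mul_rpow (by positivity) (by positivity)]
    have h7 : ‖v - ratPoint q' p'‖ ≤ ‖y - v‖ + ‖y - ratPoint q' p'‖ := by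
      have := norm_sub_le (y - ratPoint q' p') (y - v)
      rw [sub_sub_sub_cancel_left] at this
      linarith
    have h8 : (q' : ℝ) * ψ q' ≤ q' * ‖y - ratPoint q' p'‖ := by
      have h9 : (q' : ℝ) * ‖v - ratPoint q' p'‖ ≤
          q' * ‖y - v‖ + q' * ‖y - ratPoint q' p'‖ := by
        rw [← mul_add]; gcongr
      have h10 : (q' : ℝ) * ‖y - v‖ ≤ q' * ψ q := by gcongr
      linarith
    exact le_of_mul_le_mul_left h8 hq'r

/-! ### The Cantor construction -/

open scoped NNReal in
/-- The parameters of the construction of a Cantor set of exactly `ψ`-approximable points. -/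
structure CantorParam (n : ℕ) (ψ : ℕ → ℝ) where
  /-- the subdivision parameter -/
  M : ℕ
  /-- a bound for the constant comparing the heights in one stage -/
  J : ℕ
  /-- the Dirichlet exponent -/
  α : ℝ
  /-- the simplex constant -/
  κ : ℝ
  /-- an exponent exceeding the lower order -/
  L : ℝ
  /-- the dimension of the limit set -/
  r : ℝ≥0
  /-- the dimension of a stage -/
  r' : ℝ
  /-- the tolerance at every stage -/
  δ : ℕ → ℝ
  hn : 1 ≤ n
  hpos : ∀ s : ℕ, 1 ≤ s → 0 < ψ s
  hmono : ∀ s t : ℕ, 1 ≤ s → s ≤ t → ψ t ≤ ψ s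
  hα : α = ((n : ℝ) + 1) / n
  hlittle : ∀ d : ℝ, 0 < d → ∀ᶠ t : ℕ in atTop, ψ t ≤ d * (t : ℝ) ^ (-α)
  hfreq : ∃ᶠ s : ℕ in atTop, (s : ℝ) ^ (-L) ≤ ψ s
  hM : 2 * n ≤ M
  hκ : 0 < κ
  hκ1 : κ < 1
  hκn : n.factorial * (4 * (2 * M * κ)) ^ n < 1
  hJ : (2 / (κ / (2 * M))) ^ n ≤ (J : ℝ) + 1
  hr : 0 < r
  hrr' : (r : ℝ) ≤ r'
  hrL : r * L < α * r'
  hN : (2 * (M : ℝ)) ^ r' ≤ (M ^ n / 2 : ℕ)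
  hδ : ∀ k : ℕ, 0 < δ k ∧ 2 * δ k ≤ κ ∧ δ k ≤ κ / (2 * M) / (2 * J) ∧
    4 * κ * δ k ^ (1 / n : ℝ) ≤ 1 / ((k : ℝ) + 2) * (κ / (2 * M) / (2 * J)) ^ α

/-- A cube of the construction, with the data of the stage it belongs to. -/
structure CantorState (n : ℕ) where
  /-- the number of completed stages -/
  k : ℕ
  /-- the centre -/
  x : Fin n → ℝ
  /-- the radius -/
  ρ : ℝ
  /-- the height up to which exact approximability has been arranged -/
  T : ℕ
  /-- the distance to rational points of height at most `T` -/
  τ : ℝ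
  /-- the height aimed at in the present stage -/
  s : ℕ
  /-- the mass constant of the present stage -/
  D : ℝ

namespace CantorParam

variable {n : ℕ} {ψ : ℕ → ℝ} (P : CantorParam n ψ)

/-- The constant of bad approximability. -/
noncomputable def η : ℝ := P.κ / (2 * P.M)

/-- The number of children of a cube. -/
def N : ℕ := P.M ^ n / 2

/-- The precision of the approximation in a stage. -/
noncomputable def ε (_P : CantorParam n ψ) (k : ℕ) : ℝ := 1 / ((k : ℝ) + 2)

/-- The ratio of the height reached to the height aimed at. -/
noncomputable def K : ℝ := (2 / P.η) ^ n

/-- The scale, relative to the height aimed at, at which a stage ends. -/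
noncomputable def β : ℝ := P.K ^ P.α * P.κ

/-- The height `s` is large enough to be aimed at. -/
structure ScaleGood (k : ℕ) (T : ℕ) (τ : ℝ) (s : ℕ) (D : ℝ) : Prop where
  pos : 1 ≤ s
  large : ∀ X : ℝ, (s : ℝ) ≤ 2 * P.M * P.K * X → 1 ≤ X ∧ (T : ℝ) ≤ X ∧
    P.η * X ^ (-(1 / n : ℝ)) ≤ τ ∧ ∀ t : ℕ, X < t → ψ t ≤ P.δ k * (t : ℝ) ^ (-P.α)
  le_psi : (s : ℝ) ^ (-P.L) ≤ ψ s
  mass : D * (2 * P.M * P.β * (s : ℝ) ^ (-P.α)) ^ P.r' ≤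
    (P.ε k / 4 * (s : ℝ) ^ (-P.L)) ^ (P.r : ℝ)

/-- The cubes of the construction. -/
structure Inv (j : ℕ) (σ : CantorState n) : Prop where
  ρ_pos : 0 < σ.ρ
  τ_pos : 0 < σ.τ
  D_pos : 0 < σ.D
  bad : BadlyApproximableOn P.α P.κ P.η σ.T σ.x σ.ρ
  far : ∀ y, ‖y - σ.x‖ ≤ σ.ρ → ∀ (q : ℕ) (p : Fin n → ℤ), 0 < q → q ≤ σ.T →
    σ.τ ≤ ‖y - ratPoint q p‖
  scale : 2 * P.M * P.β ≤ σ.ρ * (σ.s : ℝ) ^ P.α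
  mass : ((P.N : ℝ) ^ j)⁻¹ ≤ σ.ρ ^ (P.r : ℝ)
  mass' : ((P.N : ℝ) ^ j)⁻¹ ≤ σ.D * σ.ρ ^ P.r'
  good : P.ScaleGood σ.k σ.T σ.τ σ.s σ.D

/-- The relation between a cube and its children. -/
def Step (σ σ' : CantorState n) : Prop :=
  (σ'.k = σ.k ∧ σ'.T = σ.T ∧ σ'.s = σ.s ∧ σ'.ρ = σ.ρ / (2 * P.M)) ∨
  (σ'.k = σ.k + 1 ∧ σ.T < σ'.T ∧ ∀ y, ‖y - σ'.x‖ ≤ σ'.ρ →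
    (∀ (q : ℕ) (p : Fin n → ℤ), σ.T < q → q ≤ σ'.T →
      (1 - P.ε σ.k) * min (ψ q) (P.η * (q : ℝ) ^ (-P.α)) ≤ ‖y - ratPoint q p‖) ∧
    ∃ (q : ℕ) (p : Fin n → ℤ), σ.T < q ∧ ‖y - ratPoint q p‖ < ψ q)

theorem M_ge : (2 : ℝ) ≤ P.M := by
  exact_mod_cast (by have := P.hM; have := P.hn; omega : 2 ≤ P.M)

theorem M_pos : (0 : ℝ) < P.M := by linarith [P.M_ge]

theorem n_pos (P : CantorParam n ψ) : (0 : ℝ) < n := by exact_mod_cast P.hn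

theorem α_eq : P.α = 1 + 1 / n := by
  have := P.n_pos
  rw [P.hα]; field_simp

theorem one_le_α : 1 ≤ P.α := by
  have := P.n_pos
  rw [P.α_eq]
  have : (0 : ℝ) < 1 / n := by positivity
  linarith

theorem α_pos : 0 < P.α := by linarith [P.one_le_α]

theorem η_pos : 0 < P.η := div_pos P.hκ (by linarith [P.M_ge])

theorem two_η_le : 2 * P.η ≤ P.κ := by
  have := P.M_ge
  have := P.hκ
  rw [η, mul_div_assoc', div_le_iff₀ (by linarith)]
  nlinarith

theorem η_le_one : P.η ≤ 1 := by
  linarith [P.two_η_le, P.hκ1, P.η_pos]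

theorem one_le_K : 1 ≤ P.K := by
  refine one_le_pow₀ ?_
  rw [le_div_iff₀ P.η_pos]
  linarith [P.η_le_one]

theorem K_pos : 0 < P.K := by linarith [P.one_le_K]

theorem β_pos : 0 < P.β := mul_pos (Real.rpow_pos_of_pos P.K_pos _) P.hκ

theorem ε_pos (k : ℕ) : 0 < P.ε k := by unfold ε; positivity

theorem ε_lt_one (k : ℕ) : P.ε k < 1 := by
  unfold ε
  rw [div_lt_one (by positivity)]
  have : (0 : ℝ) ≤ k := Nat.cast_nonneg k
  linarith

theorem r'_pos : 0 < P.r' := lt_of_lt_of_le (by exact_mod_cast P.hr) P.hrr'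

theorem N_ge : 2 ≤ P.N := by
  have h1 : (1 : ℝ) < P.N := by
    refine lt_of_lt_of_le ?_ P.hN
    exact Real.one_lt_rpow (by linarith [P.M_ge]) P.r'_pos
  exact_mod_cast h1

theorem N_pos : (0 : ℝ) < P.N := by
  exact_mod_cast (by have := P.N_ge; omega : 0 < P.N)

/-- The mass falls by `N` and the radius by `2 * M`, and `(2 * M) ^ r' ≤ N`. It is applied with
exponent `r'` for the running stage and with `r` for the final dimension bound. -/
theorem mass_step {e ρ D : ℝ} {j : ℕ} (hρ : 0 < ρ) (hD : 0 ≤ D) (he : e ≤ P.r')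
    (h : ((P.N : ℝ) ^ j)⁻¹ ≤ D * ρ ^ e) :
    ((P.N : ℝ) ^ (j + 1))⁻¹ ≤ D * (ρ / (2 * P.M)) ^ e := by
  have hM := P.M_ge
  have h2 : (2 * (P.M : ℝ)) ^ e ≤ P.N :=
    (Real.rpow_le_rpow_of_exponent_le (by linarith) he).trans P.hN
  have h3 : 0 < (2 * (P.M : ℝ)) ^ e := Real.rpow_pos_of_pos (by linarith) _
  rw [pow_succ, mul_inv, Real.div_rpow hρ.le (by linarith), div_eq_mul_inv, ← mul_assoc]
  have := P.N_pos
  gcongr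

/-- The height `X` actually reached is known only when the stage ends, hence the quantifier over
every `X` comparable to `s` from below. -/
theorem eventually_large {k T : ℕ} {τ : ℝ} (hτ : 0 < τ) :
    ∀ᶠ s : ℕ in atTop, ∀ X : ℝ, (s : ℝ) ≤ 2 * P.M * P.K * X → 1 ≤ X ∧ (T : ℝ) ≤ X ∧
      P.η * X ^ (-(1 / n : ℝ)) ≤ τ ∧ ∀ t : ℕ, X < t → ψ t ≤ P.δ k * (t : ℝ) ^ (-P.α) := by
  have hn := P.n_pos
  have hc : 0 < 2 * P.M * P.K := mul_pos (by linarith [P.M_ge]) P.K_pos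
  have h1 : ∀ᶠ X : ℝ in atTop, P.η * X ^ (-(1 / n : ℝ)) ≤ τ := by
    have : Tendsto (fun X : ℝ => P.η * X ^ (-(1 / n : ℝ))) atTop (nhds (P.η * 0)) :=
      (tendsto_rpow_neg_atTop (by positivity)).const_mul _
    rw [mul_zero] at this
    exact this.eventually_le_const hτ
  obtain ⟨t₀, ht₀⟩ := eventually_atTop.1 (P.hlittle _ (P.hδ k).1)
  obtain ⟨X₀, hX₀⟩ := eventually_atTop.1 (h1.and ((eventually_ge_atTop (1 : ℝ)).and
    ((eventually_ge_atTop (T : ℝ)).and (eventually_ge_atTop (t₀ : ℝ)))))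
  filter_upwards [tendsto_natCast_atTop_atTop.eventually_ge_atTop (2 * P.M * P.K * X₀)] with s hs X hX
  have hXX : X₀ ≤ X := le_of_mul_le_mul_left (hs.trans hX) hc
  obtain ⟨ha, hb, hc, hd⟩ := hX₀ X hXX
  refine ⟨hb, hc, ha, fun t ht => ht₀ t ?_⟩
  exact_mod_cast (hd.trans ht.le)

/-- The left side decays like `s ^ (-α * r')` and the right like `s ^ (-L * r)`; `hrL` says that the
left decays faster. -/
theorem eventually_mass (k : ℕ) (D : ℝ) :
    ∀ᶠ s : ℕ in atTop, D * (2 * P.M * P.β * (s : ℝ) ^ (-P.α)) ^ P.r' ≤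
      (P.ε k / 4 * (s : ℝ) ^ (-P.L)) ^ (P.r : ℝ) := by
  have hMβ : 0 < 2 * P.M * P.β := mul_pos (by linarith [P.M_ge]) P.β_pos
  have hε := P.ε_pos k
  set c := D * (2 * P.M * P.β) ^ P.r' with hc
  set d := (P.ε k / 4) ^ (P.r : ℝ) with hd
  have hd0 : 0 < d := Real.rpow_pos_of_pos (by linarith) _
  have h0 : Tendsto (fun s : ℕ => c * (s : ℝ) ^ (-(P.α * P.r' - P.r * P.L))) atTop
      (nhds (c * 0)) :=
    ((tendsto_rpow_neg_atTop (by linarith [P.hrL])).comp tendsto_natCast_atTop_atTop).const_mul _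
  rw [mul_zero] at h0
  filter_upwards [h0.eventually_le_const hd0, eventually_ge_atTop 1] with s hs hs1
  have hs0 : (0 : ℝ) < s := by exact_mod_cast hs1
  have e1 : (2 * P.M * P.β * (s : ℝ) ^ (-P.α)) ^ P.r' =
      (2 * P.M * P.β) ^ P.r' * (s : ℝ) ^ (-P.α * P.r') := by
    rw [Real.mul_rpow hMβ.le (by positivity), ← Real.rpow_mul hs0.le]
  have e2 : (P.ε k / 4 * (s : ℝ) ^ (-P.L)) ^ (P.r : ℝ) = d * (s : ℝ) ^ (-P.L * P.r) := by
    rw [Real.mul_rpow (by linarith) (by positivity), ← Real.rpow_mul hs0.le]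
  rw [e1, e2, ← mul_assoc]
  calc c * (s : ℝ) ^ (-P.α * P.r')
      = c * (s : ℝ) ^ (-(P.α * P.r' - P.r * P.L)) * (s : ℝ) ^ (-P.L * P.r) := by
        rw [mul_assoc c, ← Real.rpow_add hs0]
        congr 2; ring
    _ ≤ d * (s : ℝ) ^ (-P.L * P.r) := by gcongr

/-- A new stage can be started from any cube. -/
theorem exists_inv {j k T : ℕ} {x : Fin n → ℝ} {ρ τ : ℝ} (hρ : 0 < ρ) (hτ : 0 < τ)
    (hbad : BadlyApproximableOn P.α P.κ P.η T x ρ)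
    (hfar : ∀ y, ‖y - x‖ ≤ ρ → ∀ (q : ℕ) (p : Fin n → ℤ), 0 < q → q ≤ T → τ ≤ ‖y - ratPoint q p‖)
    (hmass : ((P.N : ℝ) ^ j)⁻¹ ≤ ρ ^ (P.r : ℝ)) :
    ∃ (s : ℕ) (D : ℝ), P.Inv j ⟨k, x, ρ, T, τ, s, D⟩ := by
  have hN := P.N_pos
  -- Makes `mass'` an equality at the start of the stage. It is fixed before `s`, which is then
  -- taken large in terms of it.
  set D : ℝ := ((P.N : ℝ) ^ j)⁻¹ / ρ ^ P.r' with hD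
  have hD0 : 0 < D := by positivity
  have hscale : ∀ᶠ s : ℕ in atTop, 2 * P.M * P.β ≤ ρ * (s : ℝ) ^ P.α := by
    have : Tendsto (fun s : ℕ => ρ * (s : ℝ) ^ P.α) atTop atTop :=
      ((tendsto_rpow_atTop P.α_pos).comp tendsto_natCast_atTop_atTop).const_mul_atTop hρ
    exact this.eventually_ge_atTop _
  obtain ⟨s, hs, h1, h2, h3, h4⟩ := (P.hfreq.and_eventually ((eventually_ge_atTop 1).and
    ((P.eventually_large (k := k) (T := T) hτ).and ((P.eventually_mass k D).and hscale)))).exists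
  refine ⟨s, D, hρ, hτ, hD0, hbad, hfar, h4, hmass, ?_, ⟨h1, h2, hs, h3⟩⟩
  rw [hD, div_mul_cancel₀ _ (by positivity)]

theorem exists_initial : ∃ σ : CantorState n, P.Inv 0 σ := by
  obtain ⟨s, D, h⟩ := P.exists_inv (j := 0) (k := 0) (T := 0) (x := 0) (ρ := 1) (τ := 1) one_pos
    one_pos (by
      intro y _ q p hq hqκ
      have hq' : (1 : ℝ) ≤ q := by exact_mod_cast hq
      have := Real.one_le_rpow hq' P.α_pos.le
      linarith [P.hκ1]) (by intro y _ q p h1 h2; omega) (by simp)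
  exact ⟨_, h⟩

/-- A cube at the end of a stage contains a cube of the next stage. -/
theorem exists_next_stage {j : ℕ} {σ : CantorState n} (h : P.Inv j σ) {c : Fin n → ℝ}
    (hc : ‖c - σ.x‖ ≤ σ.ρ - σ.ρ / P.M)
    (hbad : BadlyApproximableOn P.α P.κ P.η σ.T c (σ.ρ / (2 * P.M)))
    (hend : σ.ρ / (2 * P.M) * (σ.s : ℝ) ^ P.α < 2 * P.M * P.β) :
    ∃ σ' : CantorState n, P.Inv (j + 1) σ' ∧ P.Step σ σ' ∧
      Metric.closedBall σ'.x σ'.ρ ⊆ Metric.closedBall c (σ.ρ / (2 * P.M)) := by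
  have hM := P.M_ge
  have hM0 := P.M_pos
  have hκ := P.hκ
  have hη := P.η_pos
  have hK := P.one_le_K
  have hα := P.α_pos
  have hρ := h.ρ_pos
  have hn := P.n_pos
  have hε := P.ε_pos σ.k
  have hε1 := P.ε_lt_one σ.k
  set ρ' := σ.ρ / (2 * P.M) with hρ'
  have hρ'0 : 0 < ρ' := by positivity
  have hs0 : (0 : ℝ) < σ.s := by exact_mod_cast h.good.pos
  set X : ℝ := (P.κ / ρ') ^ P.α⁻¹ with hX
  have hX0 : 0 < X := by positivity
  have hXα : X ^ P.α = P.κ / ρ' := by rw [hX, Real.rpow_inv_rpow (by positivity) hα.ne']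
  have hXρ : X ^ P.α * ρ' = P.κ := by rw [hXα]; field_simp
  have hstart : P.β ≤ ρ' * (σ.s : ℝ) ^ P.α := by
    have := h.scale
    rw [hρ', div_mul_eq_mul_div, le_div_iff₀ (by positivity)]
    linarith
  -- Ensures `q ≤ K * X ≤ s`, so that monotonicity turns `ψ s ≥ s ^ (-L)` into a lower bound for `ψ
  -- q`, hence for the new radius.
  have hKX : P.K * X ≤ σ.s := by
    rw [← Real.rpow_le_rpow_iff (by positivity) hs0.le hα, Real.mul_rpow (by positivity) hX0.le,
      hXα, mul_div_assoc', div_le_iff₀ hρ'0]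
    linarith [show P.K ^ P.α * P.κ = P.β from rfl]
  have hsX : (σ.s : ℝ) ≤ 2 * P.M * P.K * X := by
    rw [← Real.rpow_le_rpow_iff hs0.le (by positivity) hα, mul_assoc,
      Real.mul_rpow (by positivity) (by positivity), Real.mul_rpow (by positivity) hX0.le, hXα]
    have h1 : 2 * (P.M : ℝ) ≤ (2 * (P.M : ℝ)) ^ P.α :=
      Real.self_le_rpow_of_one_le (by linarith) P.one_le_α
    calc (σ.s : ℝ) ^ P.α ≤ 2 * P.M * P.β / ρ' := by
          rw [le_div_iff₀ hρ'0]; linarith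
      _ = 2 * P.M * (P.K ^ P.α * (P.κ / ρ')) := by rw [β]; ring
      _ ≤ _ := by gcongr
  obtain ⟨hX1, hTX, hXτ, hψX⟩ := h.good.large X hsX
  have hsub : ∀ y, ‖y - c‖ ≤ ρ' → ‖y - σ.x‖ ≤ σ.ρ := by
    intro y hy
    have h1 := norm_add_le (y - c) (c - σ.x)
    rw [sub_add_sub_cancel] at h1
    have h2 : ρ' ≤ σ.ρ / P.M := by
      rw [hρ']; gcongr; linarith
    linarith
  obtain ⟨hδ0, hδκ, hδη, hδε⟩ := P.hδ σ.k
  obtain ⟨q, p, x', hqX, hqK, hx', hshell⟩ := hbad.exists_shell P.hn P.hpos P.hmono P.hα hη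
    P.η_le_one P.two_η_le hρ'0 hXρ hX1 (fun y hy => h.far y (hsub y hy)) hXτ P.hJ hε hε1 hδ0 hδκ
    hδη hδε hψX
  have hqr : (0 : ℝ) < q := hX0.trans hqX
  have hq : 0 < q := by exact_mod_cast hqr
  have hψq := P.hpos q hq
  have hqs : q ≤ σ.s := by exact_mod_cast hqK.trans hKX
  have hTq : σ.T < q := by exact_mod_cast hTX.trans_lt hqX
  set ρ'' := P.ε σ.k / 4 * ψ q with hρ''
  have hρ''0 : 0 < ρ'' := by positivity
  -- The heights visible at scale `ρ''` are exactly those up to `T'`; bad approximability beyond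
  -- `T'` therefore holds vacuously at the start of the new stage.
  set T' : ℕ := ⌊(P.κ / ρ'') ^ P.α⁻¹⌋₊ with hT'
  have hT'iff : ∀ q' : ℕ, q' ≤ T' ↔ (q' : ℝ) ^ P.α * ρ'' ≤ P.κ := by
    intro q'
    rw [hT', Nat.le_floor_iff (by positivity), Real.le_rpow_inv_iff_of_pos (by positivity)
      (by positivity) hα, le_div_iff₀ hρ''0]
  have hqT' : q ≤ T' := by
    rw [hT'iff]
    have h1 : (q : ℝ) ^ P.α * ψ q ≤ P.δ σ.k := by
      calc (q : ℝ) ^ P.α * ψ q ≤ (q : ℝ) ^ P.α * (P.δ σ.k * (q : ℝ) ^ (-P.α)) := by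
            gcongr
            exact hψX q hqX
        _ = P.δ σ.k * ((q : ℝ) ^ P.α * (q : ℝ) ^ (-P.α)) := by ring
        _ = P.δ σ.k := by rw [← Real.rpow_add hqr, add_neg_cancel, Real.rpow_zero, mul_one]
    have h2 : (q : ℝ) ^ P.α * ρ'' ≤ (q : ℝ) ^ P.α * ψ q := by
      gcongr
      rw [hρ'']
      nlinarith
    linarith
  have hTT' : σ.T < T' := hTq.trans_le hqT'
  have hsub' : ∀ y, ‖y - x'‖ ≤ ρ'' → ‖y - c‖ ≤ ρ' := by
    intro y hy
    have h1 := norm_add_le (y - x') (x' - c)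
    rw [sub_add_sub_cancel] at h1
    linarith
  have hT'0 : (0 : ℝ) < T' := by exact_mod_cast (by omega : 0 < T')
  set τ' : ℝ := min σ.τ ((1 - P.ε σ.k) * min (ψ T') (P.η * (T' : ℝ) ^ (-P.α))) with hτ'
  have hτ'0 : 0 < τ' := by
    have := P.hpos T' (by omega)
    exact lt_min h.τ_pos (mul_pos (by linarith) (lt_min this (by positivity)))
  have hmass : ((P.N : ℝ) ^ (j + 1))⁻¹ ≤ ρ'' ^ (P.r : ℝ) := by
    have h1 := P.mass_step hρ h.D_pos.le le_rfl h.mass'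
    have hr' := P.r'_pos
    have hD := h.D_pos
    refine h1.trans ?_
    have h2 : ρ' ≤ 2 * P.M * P.β * (σ.s : ℝ) ^ (-P.α) := by
      rw [Real.rpow_neg hs0.le, ← div_eq_mul_inv, le_div_iff₀ (by positivity)]
      exact hend.le
    have h3 : P.ε σ.k / 4 * (σ.s : ℝ) ^ (-P.L) ≤ ρ'' := by
      have h4 := h.good.le_psi
      have h5 := P.hmono q σ.s hq hqs
      rw [hρ'']
      exact mul_le_mul_of_nonneg_left (h4.trans h5) (by positivity)
    calc σ.D * ρ' ^ P.r' ≤ σ.D * (2 * P.M * P.β * (σ.s : ℝ) ^ (-P.α)) ^ P.r' := by gcongr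
      _ ≤ _ := h.good.mass
      _ ≤ ρ'' ^ (P.r : ℝ) := by gcongr
  obtain ⟨s', D', hinv⟩ := P.exists_inv (j := j + 1) (k := σ.k + 1) (T := T') (x := x') (ρ := ρ'')
    (τ := τ') hρ''0 hτ'0
    (fun y _ q' p' hq' hq'κ => absurd ((hT'iff q').2 hq'κ) (not_le.2 hq'))
    (by
      intro y hy q' p' hq' hq'T
      rcases le_or_gt q' σ.T with hle | hlt
      · exact (min_le_left _ _).trans (h.far y (hsub y (hsub' y hy)) q' p' hq' hle)
      · refine ((min_le_right _ _).trans ?_).trans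
          ((hshell y hy).2 q' p' hlt ((hT'iff q').1 hq'T))
        have hq'r : (0 : ℝ) < q' := by exact_mod_cast hq'
        refine mul_le_mul_of_nonneg_left (min_le_min (P.hmono q' T' hq' hq'T) ?_) (by linarith)
        refine mul_le_mul_of_nonneg_left ?_ hη.le
        exact Real.rpow_le_rpow_of_nonpos hq'r (by exact_mod_cast hq'T) (by linarith)) hmass
  refine ⟨_, hinv, Or.inr ⟨rfl, hTT', fun y hy => ⟨fun q' p' h1 h2 =>
    (hshell y hy).2 q' p' h1 ((hT'iff q').1 h2), q, p, hTq, (hshell y hy).1⟩⟩, ?_⟩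
  intro y hy
  rw [Metric.mem_closedBall, dist_eq_norm] at hy ⊢
  exact hsub' y hy

/-- At the end of a stage each grid cell is replaced by a single cube inside it. The number of
children and their separation are thus those of an ordinary subdivision, however small the new cubes
are. -/
theorem exists_children {j : ℕ} {σ : CantorState n} (h : P.Inv j σ) :
    ∃ c : Fin P.N → CantorState n,
      (∀ i, P.Inv (j + 1) (c i) ∧ P.Step σ (c i) ∧
        Metric.closedBall (c i).x (c i).ρ ⊆ Metric.closedBall σ.x σ.ρ) ∧
      ∀ i i', i ≠ i' → ∀ y ∈ Metric.closedBall (c i).x (c i).ρ,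
        ∀ y' ∈ Metric.closedBall (c i').x (c i').ρ, σ.ρ / P.M ≤ dist y y' := by
  have hM := P.M_ge
  have hM0 := P.M_pos
  have hρ := h.ρ_pos
  obtain ⟨c, hc, hsep⟩ := h.bad.exists_children P.hn P.hM P.hα hρ P.hκ P.hκn
  have hex : ∀ i, ∃ σ' : CantorState n, P.Inv (j + 1) σ' ∧ P.Step σ σ' ∧
      Metric.closedBall σ'.x σ'.ρ ⊆ Metric.closedBall (c i) (σ.ρ / (2 * P.M)) := by
    intro i
    rcases lt_or_ge (σ.ρ / (2 * P.M) * (σ.s : ℝ) ^ P.α) (2 * P.M * P.β) with hend | hend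
    · exact P.exists_next_stage h (hc i).1 (hc i).2 hend
    · refine ⟨⟨σ.k, c i, σ.ρ / (2 * P.M), σ.T, σ.τ, σ.s, σ.D⟩,
        ⟨by positivity, h.τ_pos, h.D_pos, (hc i).2, fun y hy => h.far y ?_, hend, ?_,
          P.mass_step hρ h.D_pos.le le_rfl h.mass', h.good⟩, Or.inl ⟨rfl, rfl, rfl, rfl⟩,
        subset_rfl⟩
      · have h1 := norm_add_le (y - c i) (c i - σ.x)
        rw [sub_add_sub_cancel] at h1
        have h2 : σ.ρ / (2 * P.M) ≤ σ.ρ / P.M := by gcongr; linarith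
        have h3 := (hc i).1
        linarith
      · have := P.mass_step (e := P.r) (D := 1) hρ zero_le_one P.hrr' (by
          rw [one_mul]; exact h.mass)
        rwa [one_mul] at this
  choose c' hinv hstep hsub using hex
  refine ⟨c', fun i => ⟨hinv i, hstep i, (hsub i).trans ?_⟩, fun i i' hii y hy y' hy' => ?_⟩
  · refine Metric.closedBall_subset_closedBall' ?_
    have h2 : σ.ρ / (2 * P.M) ≤ σ.ρ / P.M := by gcongr; linarith
    have h3 := (hc i).1
    rw [dist_eq_norm]
    linarith
  · have h1 := Metric.mem_closedBall.1 (hsub i hy)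
    have h2 := Metric.mem_closedBall.1 (hsub i' hy')
    have h3 := hsep i i' hii
    rw [← dist_eq_norm] at h3
    have h4 := dist_triangle4 (c i) y y' (c i')
    rw [dist_comm] at h1
    have h5 : 2 * σ.ρ / P.M = σ.ρ / P.M + σ.ρ / (2 * P.M) + σ.ρ / (2 * P.M) := by
      field_simp; norm_num
    linarith

/-- Every infinite branch of the construction converges to an exactly approximable point. -/
theorem mem_exactApproximableSet_of_branch {σ : ℕ → CantorState n} {y : Fin n → ℝ}
    (hσ : ∀ j, P.Inv j (σ j) ∧ P.Step (σ j) (σ (j + 1)) ∧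
      y ∈ Metric.closedBall (σ j).x (σ j).ρ) : y ∈ exactApproximableSet n ψ := by
  have hM := P.M_ge
  have hα := P.α_pos
  have hy : ∀ j, ‖y - (σ j).x‖ ≤ (σ j).ρ := fun j => by
    rw [← dist_eq_norm]; exact hσ j |>.2.2
  have hTmono : Monotone fun j => (σ j).T := monotone_nat_of_le_succ fun j => by
    rcases (hσ j).2.1 with ⟨-, h, -⟩ | ⟨-, h, -⟩
    · exact h.ge
    · exact h.le
  have hkmono : Monotone fun j => (σ j).k := monotone_nat_of_le_succ fun j => by
    rcases (hσ j).2.1 with ⟨h, -⟩ | ⟨h, -⟩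
    · exact h.ge
    · exact h ▸ Nat.le_succ _
  -- Without a jump `s` is constant while `ρ` decays geometrically, against `scale`.
  have hjump : ∀ j₀, ∃ j ≥ j₀, (σ (j + 1)).k = (σ j).k + 1 ∧ (σ j).T < (σ (j + 1)).T := by
    intro j₀
    by_contra! hno
    have hstep : ∀ j ≥ j₀, (σ (j + 1)).s = (σ j).s ∧ (σ (j + 1)).ρ = (σ j).ρ / (2 * P.M) := by
      intro j hj
      rcases (hσ j).2.1 with ⟨-, -, h⟩ | ⟨h1, h2, -⟩
      · exact h
      · exact absurd h2 (not_lt.2 (hno j hj h1))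
    have hiter : ∀ i, (σ (j₀ + i)).s = (σ j₀).s ∧
        (σ (j₀ + i)).ρ = (σ j₀).ρ * (1 / (2 * P.M)) ^ i := by
      intro i
      induction i with
      | zero => simp
      | succ i ih =>
        obtain ⟨h1, h2⟩ := hstep (j₀ + i) (by omega)
        refine ⟨h1.trans ih.1, ?_⟩
        rw [← add_assoc, h2, ih.2, pow_succ]
        ring
    have hlim : Tendsto (fun i : ℕ => (σ j₀).ρ * (1 / (2 * (P.M : ℝ))) ^ i *
        ((σ j₀).s : ℝ) ^ P.α) atTop (nhds ((σ j₀).ρ * 0 * ((σ j₀).s : ℝ) ^ P.α)) := by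
      refine ((tendsto_pow_atTop_nhds_zero_of_lt_one (by positivity) ?_).const_mul _).mul_const _
      rw [div_lt_one (by linarith)]
      linarith
    rw [mul_zero, zero_mul] at hlim
    have hMβ : 0 < 2 * P.M * P.β := mul_pos (by linarith) P.β_pos
    obtain ⟨i, hi⟩ := (hlim.eventually_lt_const hMβ).exists
    have h1 := (hσ (j₀ + i)).1.scale
    rw [(hiter i).1, (hiter i).2] at h1
    linarith
  have hkun : ∀ m, ∃ j, m ≤ (σ j).k := by
    intro m
    induction m with
    | zero => exact ⟨0, Nat.zero_le _⟩
    | succ m ih =>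
      obtain ⟨j₀, hj₀⟩ := ih
      obtain ⟨j, hj, hk, -⟩ := hjump j₀
      exact ⟨j + 1, by have := hkmono hj; simp only at this; omega⟩
  have hTun : ∀ m, ∃ j, m ≤ (σ j).T := by
    intro m
    induction m with
    | zero => exact ⟨0, Nat.zero_le _⟩
    | succ m ih =>
      obtain ⟨j₀, hj₀⟩ := ih
      obtain ⟨j, hj, -, hT⟩ := hjump j₀
      exact ⟨j + 1, by have := hTmono hj; simp only at this; omega⟩
  have hlim : Tendsto ψ atTop (nhds 0) := by
    have h1 : Tendsto (fun t : ℕ => 1 * (t : ℝ) ^ (-P.α)) atTop (nhds (1 * 0)) :=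
      ((tendsto_rpow_neg_atTop hα).comp tendsto_natCast_atTop_atTop).const_mul 1
    rw [mul_zero] at h1
    refine squeeze_zero' ?_ (P.hlittle 1 one_pos) h1
    filter_upwards [eventually_ge_atTop 1] with t ht using (P.hpos t ht).le
  refine mem_exactApproximableSet P.hpos P.hmono hlim ?_ ?_
  · intro c hc
    obtain ⟨k₀, hk₀⟩ : ∃ k₀ : ℕ, ∀ k ≥ k₀, c ≤ 1 - P.ε k := by
      have h1 : Tendsto (fun k : ℕ => 1 - P.ε k) atTop (nhds (1 - 0)) := by
        refine Tendsto.const_sub 1 ?_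
        have := (tendsto_const_div_atTop_nhds_zero_nat (1 : ℝ)).comp (tendsto_add_atTop_nat 2)
        refine this.congr fun k => ?_
        simp [ε]
      rw [sub_zero] at h1
      exact eventually_atTop.1 (h1.eventually_const_le hc)
    obtain ⟨j₀, hj₀⟩ := hkun k₀
    obtain ⟨T₁, hT₁⟩ := eventually_atTop.1 (P.hlittle _ P.η_pos)
    -- Beyond `T₁` the minimum in `Step` is `ψ q`; beyond `(σ j₀).T` the tolerance of the jump that
    -- covers `q` is small enough.
    refine ⟨max (σ j₀).T T₁, fun q p hq => ?_⟩
    have hqj₀ : (σ j₀).T < q := (le_max_left _ _).trans_lt hq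
    have hqT₁ : T₁ ≤ q := ((le_max_right _ _).trans_lt hq).le
    have hex : ∃ j, q ≤ (σ j).T := hTun q
    classical
    set j' := Nat.find hex with hj'
    have hj'q : q ≤ (σ j').T := Nat.find_spec hex
    have hj'0 : j₀ < j' := by
      by_contra! hle
      have := hTmono hle
      simp only at this
      omega
    obtain ⟨j, hjj⟩ : ∃ j, j' = j + 1 := ⟨j' - 1, by omega⟩
    have hjq : (σ j).T < q := not_le.1 (Nat.find_min hex (by omega : j < j'))
    rw [hjj] at hj'q
    rcases (hσ j).2.1 with ⟨-, h, -⟩ | ⟨-, -, h⟩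
    · omega
    · have h1 := (h y (hy (j + 1))).1 q p hjq hj'q
      rw [min_eq_left (hT₁ q hqT₁)] at h1
      refine le_trans ?_ h1
      have hjk : k₀ ≤ (σ j).k := hj₀.trans (hkmono (by omega : j₀ ≤ j))
      exact mul_le_mul_of_nonneg_right (hk₀ _ hjk) (P.hpos q (by omega)).le
  · intro T
    obtain ⟨j₀, hj₀⟩ := hTun T
    obtain ⟨j, hj, hk, -⟩ := hjump j₀
    rcases (hσ j).2.1 with ⟨h, -⟩ | ⟨-, -, h⟩
    · omega
    · obtain ⟨q, p, hq, hlt⟩ := (h y (hy (j + 1))).2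
      have := hTmono hj
      simp only at this
      exact ⟨q, p, by omega, hlt⟩

theorem le_dimH_exactApproximableSet : (P.r : ℝ≥0∞) ≤ dimH (exactApproximableSet n ψ) := by
  obtain ⟨σ₀, hσ₀⟩ := P.exists_initial
  have hM0 := P.M_pos
  refine (le_dimH_of_tree P.N_ge (C := (P.M : NNReal) ^ (P.r : ℝ)) P.hr
    (fun σ => Metric.closedBall σ.x σ.ρ) P.Inv P.Step σ₀ hσ₀
    (fun j σ h => ⟨isCompact_closedBall _ _, Metric.nonempty_closedBall.2 h.ρ_pos.le⟩)
    fun j σ h => ?_).trans (dimH_mono ?_)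
  · obtain ⟨c, hc, hsep⟩ := P.exists_children h
    refine ⟨c, hc, fun i i' hii y hy y' hy' => h.mass.trans ?_⟩
    have h1 := hsep i i' hii y hy y' hy'
    rw [NNReal.coe_rpow, NNReal.coe_natCast, ← Real.mul_rpow hM0.le dist_nonneg]
    refine Real.rpow_le_rpow h.ρ_pos.le ?_ P.r.coe_nonneg
    rw [div_le_iff₀ hM0] at h1
    linarith
  · rintro y ⟨σ, -, h⟩
    exact P.mem_exactApproximableSet_of_branch h

end CantorParam

/-! ### The lower order and the conclusion -/

theorem neg_log_div_log_lt_iff {a L : ℝ} {s : ℕ} (ha : 0 < a) (hs : 2 ≤ s) :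
    -Real.log a / Real.log s < L ↔ (s : ℝ) ^ (-L) < a := by
  have hs1 : (1 : ℝ) < s := by exact_mod_cast hs
  rw [div_lt_iff₀ (Real.log_pos hs1), ← Real.log_lt_log_iff (by positivity) ha,
    Real.log_rpow (by linarith)]
  constructor <;> intro h <;> linarith

theorem eventually_le_rpow_of_lt_lowerOrder {ψ : ℕ → ℝ} (hpos : ∀ s : ℕ, 1 ≤ s → 0 < ψ s) {L : ℝ}
    (hL : (L : EReal) < lowerOrder ψ) : ∀ᶠ s : ℕ in atTop, ψ s ≤ (s : ℝ) ^ (-L) := by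
  filter_upwards [eventually_lt_of_lt_liminf hL, eventually_ge_atTop 2] with s hs hs2
  by_contra! h
  exact lt_asymm (EReal.coe_lt_coe_iff.1 hs)
    ((neg_log_div_log_lt_iff (hpos s (by omega)) hs2).2 h)

theorem frequently_rpow_le_of_lowerOrder_lt {ψ : ℕ → ℝ} (hpos : ∀ s : ℕ, 1 ≤ s → 0 < ψ s) {L : ℝ}
    (hL : lowerOrder ψ < L) : ∃ᶠ s : ℕ in atTop, (s : ℝ) ^ (-L) ≤ ψ s := by
  refine ((frequently_lt_of_liminf_lt (by isBoundedDefault) hL).and_eventually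
    (eventually_ge_atTop 2)).mono fun s hs => ?_
  exact ((neg_log_div_log_lt_iff (hpos s (by omega)) hs.2).1 (EReal.coe_lt_coe_iff.1 hs.1)).le

theorem le_lowerOrder {ψ : ℕ → ℝ} (hpos : ∀ s : ℕ, 1 ≤ s → 0 < ψ s) {L : ℝ}
    (h : ∀ᶠ s : ℕ in atTop, ψ s ≤ (s : ℝ) ^ (-L)) : (L : EReal) ≤ lowerOrder ψ := by
  refine le_liminf_of_le (by isBoundedDefault) ?_
  filter_upwards [h, eventually_ge_atTop 2] with s hs hs2
  rw [EReal.coe_le_coe_iff]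
  by_contra! hlt
  exact absurd hs (not_le.2 ((neg_log_div_log_lt_iff (hpos s (by omega)) hs2).1 hlt))

/-- For `r' < n` a large cube has enough children. -/
theorem eventually_rpow_le_pow_div_two {n : ℕ} {e : ℝ} (he : 0 ≤ e) (hen : e < n) :
    ∀ᶠ M : ℕ in atTop, (2 * (M : ℝ)) ^ e ≤ (M ^ n / 2 : ℕ) := by
  have h1 : Tendsto (fun M : ℕ => (M : ℝ) ^ ((n : ℝ) - e)) atTop atTop :=
    (tendsto_rpow_atTop (by linarith)).comp tendsto_natCast_atTop_atTop
  filter_upwards [h1.eventually_ge_atTop (2 * 2 ^ e + 1), eventually_ge_atTop 1] with M hM hM1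
  have hMr : (1 : ℝ) ≤ M := by exact_mod_cast hM1
  have h2 : (1 : ℝ) ≤ (M : ℝ) ^ e := Real.one_le_rpow hMr he
  have h3 : (M : ℝ) ^ n = (M : ℝ) ^ ((n : ℝ) - e) * (M : ℝ) ^ e := by
    rw [← Real.rpow_add (by linarith), sub_add_cancel, Real.rpow_natCast]
  have h4 : (2 * 2 ^ e + 1) * (M : ℝ) ^ e ≤ (M : ℝ) ^ n := by
    rw [h3]; gcongr
  have h5 : (M : ℝ) ^ n ≤ 2 * ((M ^ n / 2 : ℕ) : ℝ) + 1 := by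
    exact_mod_cast (by omega : M ^ n ≤ 2 * (M ^ n / 2) + 1)
  rw [Real.mul_rpow (by norm_num) (by linarith)]
  nlinarith

open scoped NNReal in
theorem exists_cantorParam {n : ℕ} (hn : 1 ≤ n) {ψ : ℕ → ℝ} (hpos : ∀ s : ℕ, 1 ≤ s → 0 < ψ s)
    (hmono : ∀ s t : ℕ, 1 ≤ s → s ≤ t → ψ t ≤ ψ s)
    (hlittle : ∀ d : ℝ, 0 < d → ∀ᶠ t : ℕ in atTop, ψ t ≤ d * (t : ℝ) ^ (-(((n : ℝ) + 1) / n)))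
    {L : ℝ} (hL : ∃ᶠ s : ℕ in atTop, (s : ℝ) ^ (-L) ≤ ψ s) {r : ℝ≥0} (hr : 0 < r)
    (hrn : (r : ℝ) < n) (hrL : r * L < (n : ℝ) + 1) : ∃ P : CantorParam n ψ, P.r = r := by
  have hnr : (0 : ℝ) < n := by exact_mod_cast hn
  have hrr : (0 : ℝ) < r := by exact_mod_cast hr
  set α : ℝ := ((n : ℝ) + 1) / n with hα
  have hα0 : 0 < α := by positivity
  -- The condition `r * L < n + 1 = α * n` leaves room for `r'` below `n`.
  obtain ⟨r', hr'1, hr'n⟩ : ∃ r', max (r : ℝ) (r * L / α) < r' ∧ r' < n := by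
    refine exists_between (max_lt hrn ?_)
    rw [div_lt_iff₀ hα0, hα, mul_div_cancel₀ _ hnr.ne']
    exact hrL
  have hrr' : (r : ℝ) < r' := (le_max_left _ _).trans_lt hr'1
  have hrL' : r * L < α * r' := by
    have := (le_max_right _ _).trans_lt hr'1
    rw [div_lt_iff₀ hα0] at this
    linarith
  obtain ⟨M, hMN, hM⟩ := ((eventually_rpow_le_pow_div_two (hrr.le.trans hrr'.le) hr'n).and
    (eventually_ge_atTop (2 * n))).exists
  have hM0 : (1 : ℝ) ≤ M := by exact_mod_cast (by omega : 1 ≤ M)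
  -- The simplex condition becomes `n! < (n + 1) ^ n`.
  set κ : ℝ := 1 / (8 * M * ((n : ℝ) + 1)) with hκ
  have hκ0 : 0 < κ := by positivity
  have hκ1 : κ < 1 := by
    rw [hκ, div_lt_one (by positivity)]
    nlinarith
  have hκn : n.factorial * (4 * (2 * M * κ)) ^ n < 1 := by
    have h1 : 4 * (2 * M * κ) = 1 / ((n : ℝ) + 1) := by
      rw [hκ]; field_simp; norm_num
    rw [h1, div_pow, one_pow, mul_one_div, div_lt_one (by positivity)]
    have h2 : (n.factorial : ℝ) ≤ (n : ℝ) ^ n := by exact_mod_cast Nat.factorial_le_pow n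
    refine h2.trans_lt ?_
    exact pow_lt_pow_left₀ (by linarith) hnr.le (by omega)
  set η : ℝ := κ / (2 * M) with hη
  have hη0 : 0 < η := by positivity
  obtain ⟨J, hJ⟩ : ∃ J : ℕ, J = ⌈(2 / η) ^ n⌉₊ := ⟨_, rfl⟩
  have hJ0 : 0 < J := by rw [hJ]; exact Nat.ceil_pos.2 (by positivity)
  have hJr : (0 : ℝ) < J := by exact_mod_cast hJ0
  have hδ : ∀ k : ℕ, ∃ δ : ℝ, 0 < δ ∧ 2 * δ ≤ κ ∧ δ ≤ η / (2 * J) ∧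
      4 * κ * δ ^ (1 / n : ℝ) ≤ 1 / ((k : ℝ) + 2) * (η / (2 * J)) ^ α := by
    intro k
    set b : ℝ := 1 / ((k : ℝ) + 2) * (η / (2 * J)) ^ α with hb
    have hb0 : 0 < b := by positivity
    refine ⟨min (κ / 2) (min (η / (2 * J)) ((b / (4 * κ)) ^ n)), by positivity, ?_, ?_, ?_⟩
    · have := min_le_left (κ / 2) (min (η / (2 * J)) ((b / (4 * κ)) ^ n))
      linarith
    · exact (min_le_right _ _).trans (min_le_left _ _)
    · have h1 : (min (κ / 2) (min (η / (2 * J)) ((b / (4 * κ)) ^ n))) ^ (1 / n : ℝ) ≤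
          b / (4 * κ) := by
        calc _ ≤ ((b / (4 * κ)) ^ n) ^ (1 / n : ℝ) :=
              Real.rpow_le_rpow (by positivity) ((min_le_right _ _).trans (min_le_right _ _))
                (by positivity)
          _ = b / (4 * κ) := by
              rw [one_div, Real.pow_rpow_inv_natCast (by positivity) (by omega)]
      rw [le_div_iff₀ (by positivity)] at h1
      linarith
  choose δ hδ using hδ
  exact ⟨{
    M := M, J := J, α := α, κ := κ, L := L, r := r, r' := r', δ := δ
    hn := hn, hpos := hpos, hmono := hmono, hα := rfl, hlittle := hlittle, hfreq := hL, hM := hM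
    hκ := hκ0, hκ1 := hκ1, hκn := hκn, hr := hr, hrr' := hrr'.le, hrL := hrL', hN := hMN
    hJ := by
      have h1 : (2 / η) ^ n ≤ (J : ℝ) := by rw [hJ]; exact Nat.le_ceil _
      exact h1.trans (by linarith)
    hδ := hδ }, rfl⟩

open scoped NNReal in
theorem dimH_approximableSet_le_of_div_lowerOrder_lt {n : ℕ} {ψ : ℕ → ℝ}
    (hpos : ∀ s : ℕ, 1 ≤ s → 0 < ψ s) (hmono : ∀ s t : ℕ, 1 ≤ s → s ≤ t → ψ t ≤ ψ s) {r : ℝ≥0}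
    (hr : 0 < r) (h : ((((n : ℝ) + 1) / r : ℝ) : EReal) < lowerOrder ψ) :
    dimH (approximableSet n ψ) ≤ r := by
  have hrr : (0 : ℝ) < r := by exact_mod_cast hr
  obtain ⟨L, hL, hLψ⟩ := EReal.lt_iff_exists_real_btwn.1 h
  have hL' := EReal.coe_lt_coe_iff.1 hL
  have hL0 : 0 < L := lt_trans (by positivity) hL'
  rw [div_lt_iff₀ hrr] at hL'
  exact dimH_approximableSet_le hmono hr hL0 (by linarith)
    (eventually_le_rpow_of_lt_lowerOrder hpos hLψ)

theorem mainTheorem1 (n : ℕ) (hn : 1 ≤ n) (ψ : ℕ → ℝ)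
    (hpos : ∀ s : ℕ, 1 ≤ s → 0 < ψ s)
    (hmono : ∀ s t : ℕ, 1 ≤ s → s ≤ t → ψ t ≤ ψ s)
    (hlittle : ψ =o[atTop] fun s : ℕ => (s : ℝ) ^ (-(((n : ℝ) + 1) / (n : ℝ)))) :
    dimH (exactApproximableSet n ψ) = dimH (approximableSet n ψ) ∧
      ((dimH (approximableSet n ψ) : ℝ≥0∞) : EReal) = ((n : EReal) + 1) / lowerOrder ψ := by
  have hnr : (0 : ℝ) < n := by exact_mod_cast hn
  have hle : dimH (exactApproximableSet n ψ) ≤ dimH (approximableSet n ψ) :=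
    dimH_mono Set.sdiff_subset
  have hlittle' : ∀ d : ℝ, 0 < d →
      ∀ᶠ t : ℕ in atTop, ψ t ≤ d * (t : ℝ) ^ (-(((n : ℝ) + 1) / n)) := by
    intro d hd
    filter_upwards [hlittle.bound hd] with t ht
    rw [Real.norm_of_nonneg (by positivity : (0 : ℝ) ≤ (t : ℝ) ^ (-(((n : ℝ) + 1) / n)))] at ht
    exact (le_abs_self _).trans ht
  have hα : ((((n : ℝ) + 1) / n : ℝ) : EReal) ≤ lowerOrder ψ :=
    le_lowerOrder hpos (by simpa using hlittle' 1 one_pos)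
  generalize hlam : lowerOrder ψ = lam at hα
  induction lam with
  | bot => exact absurd hα (not_le.2 (EReal.bot_lt_coe _))
  | top =>
    have h0 : dimH (approximableSet n ψ) = 0 := by
      refine le_antisymm (ENNReal.le_of_forall_pos_le_add fun r hr _ => ?_) zero_le
      rw [zero_add]
      exact dimH_approximableSet_le_of_div_lowerOrder_lt hpos hmono hr
        (by rw [hlam]; exact EReal.coe_lt_top _)
    rw [h0] at hle ⊢
    exact ⟨le_antisymm hle zero_le, by simp⟩
  | coe L₀ =>
    have hαL := EReal.coe_le_coe_iff.1 hα
    have hL₀ : 0 < L₀ := lt_of_lt_of_le (by positivity) hαL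
    have hup : dimH (approximableSet n ψ) ≤ ENNReal.ofReal (((n : ℝ) + 1) / L₀) := by
      by_contra! hlt
      obtain ⟨r, hr1, hr2⟩ := ENNReal.lt_iff_exists_nnreal_btwn.1 hlt
      rw [ENNReal.ofReal_lt_coe_iff (by positivity)] at hr1
      have hr0 : (0 : ℝ) < r := lt_trans (by positivity) hr1
      refine absurd (dimH_approximableSet_le_of_div_lowerOrder_lt (n := n) hpos hmono
        (r := r) (by exact_mod_cast hr0) ?_) (not_le.2 hr2)
      rw [hlam, EReal.coe_lt_coe_iff, div_lt_iff₀ hr0]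
      rw [div_lt_iff₀ hL₀] at hr1
      linarith
    have hlow : ENNReal.ofReal (((n : ℝ) + 1) / L₀) ≤ dimH (exactApproximableSet n ψ) := by
      refine ENNReal.le_of_forall_nnreal_lt fun r hr => ?_
      rcases eq_or_lt_of_le (zero_le (a := r)) with rfl | hr0
      · simp
      have hrr : (0 : ℝ) < r := by exact_mod_cast hr0
      have hr' : (r : ℝ) < ((n : ℝ) + 1) / L₀ := by
        rwa [← ENNReal.ofReal_coe_nnreal, ENNReal.ofReal_lt_ofReal_iff (by positivity)] at hr
      -- Here `λ ≥ (n + 1) / n` enters: a stage cannot supply dimension `n` or more.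
      have hrn : (r : ℝ) < n := by
        refine hr'.trans_le ?_
        rw [div_le_iff₀ hL₀]
        rw [div_le_iff₀ hnr] at hαL
        linarith
      have hL₀r : L₀ < ((n : ℝ) + 1) / r := by
        rw [lt_div_iff₀ hL₀] at hr'
        rw [lt_div_iff₀ hrr]
        linarith
      obtain ⟨L, hL1, hL2⟩ := exists_between hL₀r
      rw [lt_div_iff₀ hrr] at hL2
      obtain ⟨P, hP⟩ := exists_cantorParam hn hpos hmono hlittle'
        (frequently_rpow_le_of_lowerOrder_lt hpos (L := L)
          (by rw [hlam]; exact EReal.coe_lt_coe_iff.2 hL1)) hr0 hrn (by linarith)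
      rw [← hP]
      exact P.le_dimH_exactApproximableSet
    have heq := le_antisymm hup (hlow.trans hle)
    refine ⟨le_antisymm hle (hup.trans hlow), ?_⟩
    rw [heq, EReal.coe_ennreal_ofReal, max_eq_left (by positivity), EReal.coe_div]
    norm_cast
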